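/- **Conventions.** All posets are finite. A graded poset $X$ has a dimension function $\dim:X\to\mathbb Z$ that is monotone and increases by $1$ along covering pairs; $X(i)$ is the set of $i$-dimensional faces. $X$ is a $d$-poset if every face lies in a $d$-face and there is a face $\emptyset_X$ of dimension $-1$ below all faces. $\mathrm{Inf}\,A$ is the set of maximal lower bounds of $A$. $F^{\max}_{i,j,k}(X)$ and $F^{\min}_{i,j,k}(X)$ are the maximal and minimal numbers of $j$-faces between an $i$-face and a $k$-face that are incident, $F^{\max}_{i,j}=F^{\max}_{-1,i,j}$, and the lower irregularity is $L(X)=\max_{-1\le i\le j\le k\le d}F^{\max}_{i,j,k}/F^{\min}_{i,j,k}$. A weight $w:X\to(0,\infty)$ is proper if $w(X(d))=1$ and $w(x)=\sum_{y\in X(d),\,y\ge x} w(y)/|\{x'\in X(\dim x):x'\le y\}|$ for all $x$. The link $X_u=\{x\ge u\}$ is graded by $\dim x-\dim u-1$ and carries the weight $$w_u(x)=\frac1{w(\{y\in X(d):y\ge u\})}\sum_{y\in X(d),\,y\ge x}\frac{w(y)}{|\{x'\in X(\dim x):u\le x'\le y\}|}.$$ For a commutative ring $R$, an $R$-orientation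 assigns $[y:x]\in R^\times$ to covering pairs $x\lhd y$ so that $\sum_{x<y<z}[z:y][y:x]=0$ whenever $x\le z$, $\dim z=\dim x+2$. An $R$-sheaf $\mathcal F$ on $X$ consists of $R$-modules $\mathcal F(x)$ and linear maps $\mathrm{res}_{y\leftarrow x}:\mathcal F(x)\to\mathcal F(y)$ for $x\le y$, with $\mathrm{res}_{x\leftarrow x}=\mathrm{id}$ and $\mathrm{res}_{z\leftarrow y}\circ\mathrm{res}_{y\leftarrow x}=\mathrm{res}_{z\leftarrow x}$; $C^i=\prod_{x\in X(i)}\mathcal F(x)$, $(df)(y)=\sum_{x\in X(i),\,x\le y}[y:x]\,\mathrm{res}_{y\leftarrow x}f(x)$ for $f\in C^i$, $y\in X(i+1)$; $Z^i=\ker d|_{C^i}$, $B^i=d(C^{i-1})$. Links carry the restricted orientation and the restricted sheaf $\mathcal F_u$. For $g\in C^{i-\dim u-1}(X_u,\mathcal F_u)$, $g^u\in C^i(X,\mathcal F)$ is its extension by zero. Put $\|f\|=w(\mathrm{supp}\,f)$, $\mathrm{dist}(f,g)=\|f-g\|$, and let $\mathrm{dist}(f,S)$ be the infimum of $\mathrm{dist}(f,g)$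 over $g\in S$. Define $\mathrm{cse}_i$ (resp. $\mathrm{cbe}_i$) as the supremum in $[0,\infty]$ of all $\mu\in[0,\infty)$ such that $\|df\|\ge\mu\,\mathrm{dist}(f,Z^i)$ (resp. $\|df\|\ge\mu\,\mathrm{dist}(f,B^i)$) for all $f\in C^i$, and $\mathrm{ccd}_i=\inf\{\|f\|:f\in Z^i\setminus B^i\}\in[0,\infty]$. For a weighted $d$-poset $(X,w)$ and $0\le i,j<k\le d$, the no-intersection hypergraph $\mathrm{NI}^{i,j,k}(X,w)$ has vertices $X(i)\cup X(j)$, hyperedges $X(k)$ and incidence $\le$; a hyperedge $z$ has weight $w(z)$, a vertex $x$ has weight $w(x)$ if $i=j$ and $w(x)/2$ if $i\ne j$; and $x\sim y$ means that $x,y\le z$ for some $z\in X(k)$, $\mathrm{Inf}\{x,y\}=\{\emptyset_X\}$ and $(\dim x,\dim y)\in\{(i,j),(j,i)\}$. For $u\in X(b)$ with $b<i,j<k$, put $\mathrm{NI}^{i,j,k}_u(X)=\mathrm{NI}^{i-b-1,j-b-1,k-b-1}(X_u,w_u)$. Such a hypergraph is an $(\alpha,\beta)$-skeleton expander if, for every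 set $A$ of vertices, the hyperedges containing two distinct vertices $x,y\in A$ with $x\sim y$ have total weight at most $\alpha w(A)+\beta w(A)^2$. An abstract $k$-intersection profile $\mathcal P$ is a set of integer quadruples $(t,\ell,r,b)$ with $k+1\ge t>\ell\ge r>b\ge-1$, together with a set $\mathrm{Ad}(\mathcal P)$ of integer pairs $(i,j)$ with $k+1\ge i>j\ge-1$, such that: (1) $(t,\ell),(t,r),(\ell,b),(r,b)\in\mathrm{Ad}(\mathcal P)$ for each $(t,\ell,r,b)\in\mathcal P$; (2) if $t>\ell\ge r>-1$ and $(t,r),(t,\ell)\in\mathrm{Ad}(\mathcal P)$, then $(t,\ell,r,b)\in\mathcal P$ for some $b$; (3) if $t>\ell>r\ge-1$ and $(t,\ell),(t,r)\in\mathrm{Ad}(\mathcal P)$, then $(\ell,r)\in\mathrm{Ad}(\mathcal P)$; (4) $(k+1,k)$ and $(k+1,-1),\dots,(0,-1)$ are in $\mathrm{Ad}(\mathcal P)$. It is a $k$-intersection profile for $X$ if for all faces $x>y$, $x>z$ with $(\dim x,\dim y),(\dim x,\dim z)\in\mathrm{Ad}(\mathcal P)$ and $\dim y\ge\dim z$,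 either $y\ge z$ or $(\dim x,\dim y,\dim z,\dim v)\in\mathcal P$ for every $v\in\mathrm{Inf}\{y,z\}$. The correction algorithm with parameter $q\ge0$, applied to $f\in C^k(X,\mathcal F)$: set $f_0=f$, $i=0$. As long as there are $u\in X(0)\cup\dots\cup X(k)$ and $g\in C^{k-\dim u-1}(X_u,\mathcal F_u)$ with $\|df_i+d(g^u)\|<\|df_i\|-q\,w(u)$, choose any such $u,g$, set $f_{i+1}=f_i+g^u$ and increase $i$ by $1$. When there are none, return $f_i$. **Theorem.** Let $B\in[0,\infty)$, let $F,k\ge0$ be integers and let $L\in[1,\infty)$. There are constants $K,K'\in(0,1]$, depending only on $B,F,L,k$, with the following property. Let $R$ be a commutative ring, let $d\ge k+2$, let $(X,w)$ be a properly weighted $R$-oriented $d$-poset with lower irregularity at most $L$ and $F^{\max}_{i,j}(X)\le F$ for all $-1\le i\le j\le k+2$, let $\mathcal P$ be a $k$-intersection profile for $X$ and $\mathcal P'$ a $(k+1)$-intersection profile for $X$, let $\mathcal F$ be an $R$-sheaf on $X$, and let $\varepsilon\in(0,1]$, $B'\in[1,\infty)$. Suppose that: * (1a) $\mathrm{cbe}_{k-\dim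 u-1}(X_u,w_u,\mathcal F_u)\ge\varepsilon$ for every $u\in X(0)\cup\dots\cup X(k)$; * (1b) $\mathrm{cbe}_{k-\dim u}(X_u,w_u,\mathcal F_u)\ge\varepsilon$ for every $u\in X(0)\cup\dots\cup X(k+1)$; * (2a) for every $(t,\ell,r,b)\in\mathcal P\cup\mathcal P'$ with $b>-1$ and every $u\in X(b)$, $\mathrm{NI}^{\ell,r,t}_u(X)$ is a $\bigl((K\varepsilon)^{2^{k+1-r}},\,B(K\varepsilon)^{-2^{k+1-r}(2^{r-1-b}-1)}\bigr)$-skeleton expander; * (2b) for every $(t,\ell,r,b)\in\mathcal P\cup\mathcal P'$ with $b=-1$, $\mathrm{NI}^{\ell,r,t}(X,w)$ is a $\bigl((K\varepsilon)^{2^{k+1-r}},\,B'B(K\varepsilon)^{-2^{k+1-r}(2^{r}-1)}\bigr)$-skeleton expander. Then $$\mathrm{cse}_k(X,w,\mathcal F)\ge B'^{-1}K'(K\varepsilon)^{2^{k+2}-1},\qquad \mathrm{ccd}_k(X,w,\mathcal F)\ge B'^{-1}K'(K\varepsilon)^{2^{k+1}-1}.$$ Moreover, if $f\in C^k(X,\mathcal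 F)$ satisfies $\mathrm{dist}(f,Z^k)<B'^{-1}K'(K\varepsilon)^{2^{k+2}-1}$, then the correction algorithm applied to $f$ with parameter $q=K(K\varepsilon)^{2^{k+1}-1}$ always stops, and whatever choices it makes, it returns some $f'\in Z^k$ with $\mathrm{dist}(f,f')\le K'^{-1}(K\varepsilon)^{-2^{k+1}}\,\mathrm{dist}(f,Z^k)$. -/

import Mathlib

open scoped NNReal ENNReal

universe u v w

noncomputable section

namespace PosetExp

/-! ### Graded posets

A finite graded poset is a finite partial order with Mathlib's class `GradeOrder ℤ X`:
the dimension is strictly monotone and increases by one along covering pairs. -/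

section Graded

variable {X : Type u} [PartialOrder X] [GradeOrder ℤ X]

/-- The dimension function of a graded poset. -/
def dim (x : X) : ℤ := grade ℤ x

/-- The set of infima of `A`: the maximal lower bounds of `A`. -/
def infima (A : Set X) : Set X := {b | Maximal (fun c => c ∈ lowerBounds A) b}

variable (X) in
/-- `X` is a `d`-poset: every face lies in a `d`-face, and there is a face of dimension `-1`
which is a subface of every face. -/
structure IsDPoset (d : ℕ) : Prop where
  pure : ∀ x : X, ∃ y : X, dim y = d ∧ x ≤ y
  empty_face : ∃ e : X, dim e = -1 ∧ ∀ x : X, e ≤ x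

variable (X) in
/-- The possible numbers of `j`-faces between an incident `i`-face and `k`-face. -/
def betweenCounts (i j k : ℤ) : Set ℕ :=
  {n | ∃ x z : X, dim x = i ∧ dim z = k ∧ x ≤ z ∧ n = {y : X | dim y = j ∧ x ≤ y ∧ y ≤ z}.ncard}

variable (X) in
/-- Maximal number of `j`-faces between an `i`-face and a `k`-face (`0` if there are none). -/
def Fmax (i j k : ℤ) : ℕ := sSup (betweenCounts X i j k)

variable (X) in
/-- Minimal number of `j`-faces between an `i`-face and a `k`-face (`0` if there are none). -/
def Fmin (i j k : ℤ) : ℕ := sInf (betweenCounts X i j k)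

variable (X) in
/-- The lower irregularity of a `d`-poset: the largest ratio of `Fmax` to `Fmin`. -/
def lowerIrregularity (d : ℕ) : ℝ :=
  sSup {c | ∃ i j k : ℤ, -1 ≤ i ∧ i ≤ j ∧ j ≤ k ∧ k ≤ d ∧
    c = (Fmax X i j k : ℝ) / (Fmin X i j k : ℝ)}

end Graded

/-! ### Links -/

/-- The link of `X` at `z`: the faces containing `z`. -/
abbrev Link {X : Type u} [PartialOrder X] (z : X) : Type u := {x : X // z ≤ x}

section LinkInstances

variable {X : Type u} [PartialOrder X] (z : X)

open Classical in
instance [Fintype X] : Fintype (Link z) := Subtype.fintype _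

theorem link_covBy {z : X} {x y : Link z} (h : x ⋖ y) : x.1 ⋖ y.1 :=
  ⟨h.1, fun c hxc hcy => h.2 (c := (⟨c, x.2.trans hxc.le⟩ : Link z)) hxc hcy⟩

/-- The dimension in the link at `z` is `dim x - dim z - 1`. -/
instance [GradeOrder ℤ X] : GradeOrder ℤ (Link z) where
  grade x := grade ℤ x.1 - grade ℤ z - 1
  grade_strictMono := fun x y h => by
    have h1 : grade ℤ x.1 < grade ℤ y.1 := grade_strictMono (show x.1 < y.1 from h)
    show grade ℤ x.1 - grade ℤ z - 1 < grade ℤ y.1 - grade ℤ z - 1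
    omega
  covBy_grade := fun {x y} h => by
    have h1 : grade ℤ x.1 ⋖ grade ℤ y.1 := (link_covBy h).grade ℤ
    rw [Order.covBy_iff_add_one_eq] at h1 ⊢
    omega

theorem dim_link [GradeOrder ℤ X] (x : Link z) : dim x = dim x.1 - dim z - 1 := rfl

end LinkInstances

/-! ### Weights -/

section Weights

variable {X : Type u} [PartialOrder X] [GradeOrder ℤ X] [Fintype X]

/-- The total weight of a set. -/
def weightOf {V : Type*} [Fintype V] (w : V → ℝ) (A : Set V) : ℝ := ∑ x, A.indicator w x

/-- `w` is a proper (positive) weight function on the graded poset `X` of dimension `d`. -/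
structure IsProperWeight (d : ℕ) (w : X → ℝ) : Prop where
  pos : ∀ x, 0 < w x
  total : weightOf w {x : X | dim x = d} = 1
  proper : ∀ x : X, w x =
    weightOf (fun y : X => w y / ({x' : X | dim x' = dim x ∧ x' ≤ y}.ncard : ℝ))
      {y : X | dim y = d ∧ x ≤ y}

/-- The weight function induced on the link at `z` by a weight function `w` on a graded poset `X`
which is pure of dimension `d`. -/
def linkWeight (d : ℕ) (w : X → ℝ) (z : X) (x : Link z) : ℝ :=
  (weightOf w {y : X | dim y = d ∧ z ≤ y})⁻¹ *
    weightOf (fun y : X => w y / ({x' : X | dim x' = dim x.1 ∧ z ≤ x' ∧ x' ≤ y}.ncard : ℝ))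
      {y : X | dim y = d ∧ x.1 ≤ y}

end Weights

/-! ### Orientations, sheaves and cochains -/

/-- An `R`-orientation on a graded poset. `coeff y x` is `[y : x]`; only its values at
covering pairs `x ⋖ y` are ever used. -/
structure PosetOrientation (R : Type v) [CommRing R] (X : Type u) [PartialOrder X] [GradeOrder ℤ X] where
  coeff : X → X → Rˣ
  sum_eq_zero : ∀ x z : X, x ≤ z → dim z = dim x + 2 →
    ∑ᶠ y ∈ {y : X | x < y ∧ y < z}, (coeff z y : R) * (coeff y x : R) = 0

/-- The orientation inherited by a link. -/
def PosetOrientation.link {R : Type v} [CommRing R] {X : Type u} [PartialOrder X] [GradeOrder ℤ X]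
    (o : PosetOrientation R X) (z : X) : PosetOrientation R (Link z) where
  coeff y x := o.coeff y.1 x.1
  sum_eq_zero := by
    intro a c hac hd
    have key := o.sum_eq_zero a.1 c.1 hac (by
      have h1 := dim_link z a
      have h2 := dim_link z c
      omega)
    have himg : {y : X | a.1 < y ∧ y < c.1} =
        (fun y : Link z => y.1) '' {y : Link z | a < y ∧ y < c} := by
      ext y
      constructor
      · rintro ⟨h1, h2⟩
        exact ⟨⟨y, a.2.trans h1.le⟩, ⟨h1, h2⟩, rfl⟩
      · rintro ⟨y', ⟨h1, h2⟩, rfl⟩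
        exact ⟨h1, h2⟩
    rw [himg, finsum_mem_image (fun _ _ _ _ h => Subtype.ext h)] at key
    exact key

/-- An `R`-sheaf on a poset. -/
structure PosetSheaf (R : Type v) [CommRing R] (X : Type u) [PartialOrder X] where
  obj : X → Type w
  [addCommGroup : ∀ x, AddCommGroup (obj x)]
  [module : ∀ x, Module R (obj x)]
  res : ∀ {x y : X}, x ≤ y → (obj x →ₗ[R] obj y)
  res_refl : ∀ x : X, res (le_refl x) = LinearMap.id
  res_comp : ∀ {x y z : X} (hxy : x ≤ y) (hyz : y ≤ z),
    (res hyz).comp (res hxy) = res (hxy.trans hyz)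

attribute [instance] PosetSheaf.addCommGroup PosetSheaf.module

section Cochains

variable {R : Type v} [CommRing R] {X : Type u} [PartialOrder X]

/-- The restriction of a sheaf to a link. -/
def PosetSheaf.link (F : PosetSheaf.{u, v, w} R X) (z : X) : PosetSheaf.{u, v, w} R (Link z) where
  obj x := F.obj x.1
  res {x y} h := F.res (show x.1 ≤ y.1 from h)
  res_refl x := F.res_refl x.1
  res_comp {x y z'} h h' := F.res_comp (show x.1 ≤ y.1 from h) (show y.1 ≤ z'.1 from h')

variable [GradeOrder ℤ X]

/-- The `i`-cochains with coefficients in `F`. -/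
abbrev Cochain (F : PosetSheaf.{u, v, w} R X) (i : ℤ) : Type (max u w) :=
  ∀ x : {x : X // dim x = i}, F.obj x.1

/-- The support of an `i`-cochain. -/
def supp {F : PosetSheaf.{u, v, w} R X} {i : ℤ} (f : Cochain F i) : Set X :=
  {x | ∃ h : dim x = i, f ⟨x, h⟩ ≠ 0}

open Classical in
/-- Extension by zero of a cochain on the link at `z` to a cochain on `X`. -/
def extendLink (F : PosetSheaf.{u, v, w} R X) (z : X) (i : ℤ)
    (g : Cochain (F.link z) (i - dim z - 1)) : Cochain F i :=
  fun x => if h : z ≤ x.1 then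
    g ⟨(⟨x.1, h⟩ : Link z), by rw [dim_link, x.2]⟩ else 0

variable [Fintype X]

open Classical in
/-- The coboundary map `C^i → C^j`, where `j = i + 1`. -/
def coboundary (o : PosetOrientation R X) (F : PosetSheaf.{u, v, w} R X) (i j : ℤ) (_hij : i + 1 = j) :
    Cochain F i →ₗ[R] Cochain F j :=
  LinearMap.pi fun y => ∑ x : {x : X // dim x = i},
    if h : x.1 ≤ y.1 then (o.coeff y.1 x.1 : R) • (F.res h).comp (LinearMap.proj x) else 0

/-- The coboundary of an `i`-cochain. -/
def cobd (o : PosetOrientation R X) {F : PosetSheaf.{u, v, w} R X} {i : ℤ} (f : Cochain F i) :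
    Cochain F (i + 1) := coboundary o F i (i + 1) rfl f

/-- The `i`-cocycles. -/
def cocycles (o : PosetOrientation R X) (F : PosetSheaf.{u, v, w} R X) (i : ℤ) :
    Submodule R (Cochain F i) := LinearMap.ker (coboundary o F i (i + 1) rfl)

/-- The `i`-coboundaries. -/
def coboundaries (o : PosetOrientation R X) (F : PosetSheaf.{u, v, w} R X) (i : ℤ) :
    Submodule R (Cochain F i) := LinearMap.range (coboundary o F (i - 1) i (sub_add_cancel i 1))

/-- The weighted Hamming norm `w (supp f)`. -/
def wnorm (w : X → ℝ) {F : PosetSheaf.{u, v, w} R X} {i : ℤ} (f : Cochain F i) : ℝ :=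
  weightOf w (supp f)

/-- The distance of two cochains. -/
def wdist (w : X → ℝ) {F : PosetSheaf.{u, v, w} R X} {i : ℤ} (f g : Cochain F i) : ℝ :=
  wnorm w (f - g)

/-- The distance from a cochain to a (nonempty) set of cochains. -/
def wdistTo (w : X → ℝ) {F : PosetSheaf.{u, v, w} R X} {i : ℤ} (f : Cochain F i)
    (S : Set (Cochain F i)) : ℝ := ⨅ g : S, wdist w f g.1

/-! ### Cosystolic and coboundary expansion -/

/-- The `i`-cosystolic expansion: the supremum (possibly `∞`) of the `μ ≥ 0` such that
`‖d f‖ ≥ μ * dist (f, Z^i)` for all `f`. -/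
def cse (o : PosetOrientation R X) (w : X → ℝ) (F : PosetSheaf.{u, v, w} R X) (i : ℤ) : ℝ≥0∞ :=
  ⨆ μ ∈ {μ : ℝ≥0 | ∀ f : Cochain F i,
    (μ : ℝ) * wdistTo w f (cocycles o F i : Set (Cochain F i)) ≤ wnorm w (cobd o f)}, (μ : ℝ≥0∞)

/-- The `i`-cocycle distance: the infimum (possibly `∞`) of the norms of the `i`-cocycles that are
not coboundaries. -/
def ccd (o : PosetOrientation R X) (w : X → ℝ) (F : PosetSheaf.{u, v, w} R X) (i : ℤ) : ℝ≥0∞ :=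
  ⨅ f ∈ {f : Cochain F i | f ∈ cocycles o F i ∧ f ∉ coboundaries o F i},
    ENNReal.ofReal (wnorm w f)

/-- The `i`-coboundary expansion: the supremum (possibly `∞`) of the `μ ≥ 0` such that
`‖d f‖ ≥ μ * dist (f, B^i)` for all `f`. -/
def cbe (o : PosetOrientation R X) (w : X → ℝ) (F : PosetSheaf.{u, v, w} R X) (i : ℤ) : ℝ≥0∞ :=
  ⨆ μ ∈ {μ : ℝ≥0 | ∀ f : Cochain F i,
    (μ : ℝ) * wdistTo w f (coboundaries o F i : Set (Cochain F i)) ≤ wnorm w (cobd o f)},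
    (μ : ℝ≥0∞)

/-! ### The correction algorithm -/

/-- One pass through the loop of the correction algorithm with parameter `q`: it may replace `f`
by `f'`. -/
def CorrectionStep (o : PosetOrientation R X) (w : X → ℝ) (F : PosetSheaf.{u, v, w} R X) (k : ℤ)
    (q : ℝ) (f f' : Cochain F k) : Prop :=
  ∃ z : X, 0 ≤ dim z ∧ dim z ≤ k ∧ ∃ g : Cochain (F.link z) (k - dim z - 1),
    wnorm w (cobd o f + cobd o (extendLink F z k g)) < wnorm w (cobd o f) - q * w z ∧
    f' = f + extendLink F z k g

/-- `f'` is a possible output of the correction algorithm on input `f`: it is reached by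
finitely many passes and no further pass is possible. -/
def CorrectionOutput (o : PosetOrientation R X) (w : X → ℝ) (F : PosetSheaf.{u, v, w} R X) (k : ℤ)
    (q : ℝ) (f f' : Cochain F k) : Prop :=
  Relation.ReflTransGen (CorrectionStep o w F k q) f f' ∧
    ∀ f'' : Cochain F k, ¬ CorrectionStep o w F k q f' f''

/-- Every run of the correction algorithm on input `f` stops. -/
def CorrectionTerminates (o : PosetOrientation R X) (w : X → ℝ) (F : PosetSheaf.{u, v, w} R X) (k : ℤ)
    (q : ℝ) (f : Cochain F k) : Prop :=
  ¬ ∃ s : ℕ → Cochain F k, s 0 = f ∧ ∀ n, CorrectionStep o w F k q (s n) (s (n + 1))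

end Cochains

/-! ### Related weighted hypergraphs and skeleton expansion -/

/-- A related weighted hypergraph with vertices `V` and hyperedges `E`. -/
structure RelHypergraph (V E : Type u) where
  inc : V → E → Prop
  wV : V → ℝ
  wE : E → ℝ
  rel : V → V → Prop
  exists_inc_of_rel : ∀ {x y : V}, rel x y → ∃ e, inc x e ∧ inc y e

/-- The hyperedges containing two distinct related vertices of `A`. -/
def RelHypergraph.E₂ {V E : Type u} (H : RelHypergraph V E) (A : Set V) : Set E :=
  {e | ∃ x ∈ A, ∃ y ∈ A, x ≠ y ∧ H.inc x e ∧ H.inc y e ∧ H.rel x y}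

/-- `(α, β)`-skeleton expansion. -/
def RelHypergraph.IsSkeletonExpander {V E : Type u} [Fintype V] [Fintype E]
    (H : RelHypergraph V E) (α β : ℝ) : Prop :=
  ∀ A : Set V, weightOf H.wE (H.E₂ A) ≤ α * weightOf H.wV A + β * weightOf H.wV A ^ 2

section NoIntersection

variable {X : Type u} [PartialOrder X] [GradeOrder ℤ X]

/-- The `(i, j, k)`-no-intersection hypergraph of a weighted poset with an empty face. -/
def noIntersection (w : X → ℝ) (i j k : ℤ) :
    RelHypergraph {x : X // dim x = i ∨ dim x = j} {z : X // dim z = k} where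
  inc x z := x.1 ≤ z.1
  wV x := if i = j then w x.1 else w x.1 / 2
  wE z := w z.1
  rel x y := (∃ z : {z : X // dim z = k}, x.1 ≤ z.1 ∧ y.1 ≤ z.1) ∧
    (∃ e : X, IsBot e ∧ infima {x.1, y.1} = {e}) ∧
    ((dim x.1 = i ∧ dim y.1 = j) ∨ (dim x.1 = j ∧ dim y.1 = i))
  exists_inc_of_rel h := h.1

/-- The no-intersection hypergraph of the link at `z`, with the dimensions `i, j, k`
taken in `X`; here `X` has dimension `d`. -/
def noIntersectionLink [Fintype X] (d : ℕ) (w : X → ℝ) (z : X) (i j k : ℤ) :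
    RelHypergraph {x : Link z // dim x = i - dim z - 1 ∨ dim x = j - dim z - 1}
      {y : Link z // dim y = k - dim z - 1} :=
  noIntersection (linkWeight d w z) (i - dim z - 1) (j - dim z - 1) (k - dim z - 1)

end NoIntersection

/-! ### Intersection profiles -/

/-- An abstract `k`-intersection profile: quadruples `(t, l, r, b)` and admissible pairs. -/
structure AbstractIntersectionProfile (k : ℕ) where
  quads : Set (ℤ × ℤ × ℤ × ℤ)
  ad : Set (ℤ × ℤ)
  quads_range : ∀ t l r b : ℤ, (t, l, r, b) ∈ quads →
    t ≤ k + 1 ∧ l < t ∧ r ≤ l ∧ b < r ∧ -1 ≤ b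
  ad_range : ∀ i j : ℤ, (i, j) ∈ ad → i ≤ k + 1 ∧ j < i ∧ -1 ≤ j
  ad_of_quads : ∀ t l r b : ℤ, (t, l, r, b) ∈ quads →
    (t, l) ∈ ad ∧ (t, r) ∈ ad ∧ (l, b) ∈ ad ∧ (r, b) ∈ ad
  exists_quad : ∀ t l r : ℤ, l < t → r ≤ l → -1 < r → (t, r) ∈ ad → (t, l) ∈ ad →
    ∃ b, (t, l, r, b) ∈ quads
  ad_of_ad : ∀ t l r : ℤ, l < t → r < l → -1 ≤ r → (t, l) ∈ ad → (t, r) ∈ ad → (l, r) ∈ ad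
  ad_top : ((k : ℤ) + 1, (k : ℤ)) ∈ ad
  ad_bot : ∀ i : ℤ, 0 ≤ i → i ≤ k + 1 → (i, -1) ∈ ad

/-- The pair of faces `(x, y)` is admissible. -/
def AbstractIntersectionProfile.Admissible {k : ℕ} (P : AbstractIntersectionProfile k)
    {X : Type u} [PartialOrder X] [GradeOrder ℤ X] (x y : X) : Prop :=
  y < x ∧ (dim x, dim y) ∈ P.ad

/-- `P` is a `k`-intersection profile for `X`. -/
def AbstractIntersectionProfile.IsProfileFor {k : ℕ} (P : AbstractIntersectionProfile k)
    (X : Type u) [PartialOrder X] [GradeOrder ℤ X] : Prop :=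
  ∀ x y z : X, P.Admissible x y → P.Admissible x z → dim z ≤ dim y →
    z ≤ y ∨ ∀ b ∈ infima {y, z}, (dim x, dim y, dim z, dim b) ∈ P.quads

end PosetExp

end

open PosetExp

/-! All three conclusions come from one vanishing statement, `eq_zero_of_locally_minimal`: a cocycle
`f` of degree `m` and small norm is zero if adding the coboundary of a cochain supported above a
single face `u` of dimension `≥ 0` never lowers its norm by more than `q * w u`. For the cosystolic
expansion and the correction algorithm it is applied in degree `k + 1` to the coboundary of a
cochain at which the algorithm is stuck; for the cocycle distance, in degree `k` with `q = 0`, to a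
lightest representative of a class modulo coboundaries.

The vanishing is proved with heavy faces. The `m`-faces of `supp f` are heavy, and, going down, a
face is heavy if the heavy faces of some larger dimension above it weigh enough compared with it, as
measured by thresholds `π`. The heavy `r`-faces weigh at most a constant times `‖f‖ / π r`, so
smallness of `f` keeps the empty face from being heavy. A face is bad if two of its heavy admissible
subfaces have a non-heavy infimum `v`. Little heavy weight lies above such a `v`, so skeleton
expansion in the link of `v` makes these pairs rare: the bad faces weigh at most a constant times `c
* ‖f‖`, where `c = K * ε` (`weightOf_bad_quad_le`, `weightOf_above_bad_le`). The doubly exponential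
thresholds are chosen so that the quadratic expansion term also carries this factor `c`.

Below an `(m + 1)`-face without bad subfaces, descent to heavy admissible subfaces is confluent
(`desc_terminal`). Hence all faces of `supp f` in it reach the same terminal heavy faces. Cutting
`f` down to the faces that reach a given terminal face `u` yields pieces `f_u` which cover `f` and
whose coboundaries live on `(m + 1)`-faces with bad subfaces. Coboundary expansion of the link of
`u` and local minimality (`WeightBounds.local_bound`) bound `ε * (‖f_u‖ - q * w u)` by the weight of
those faces above `u`. Summing over `u` gives `(3/4) * ε * ‖f‖ ≤ (1/4) * ε * ‖f‖`, so `f = 0`. -/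

namespace PosetExp

/-! ### Weights of sets and double counting. -/

section WeightOf

variable {V W : Type*} [Fintype V] [Fintype W]

open Classical in
theorem weightOf_eq_sum_filter (w : V → ℝ) (A : Set V) :
    weightOf w A = ∑ x with x ∈ A, w x := by
  simp only [weightOf, Set.indicator_apply, Finset.sum_filter]

theorem weightOf_nonneg {w : V → ℝ} (hw : ∀ x, 0 ≤ w x) (A : Set V) : 0 ≤ weightOf w A :=
  Finset.sum_nonneg fun x _ => Set.indicator_nonneg (fun x _ => hw x) x

theorem weightOf_mono {w : V → ℝ} (hw : ∀ x, 0 ≤ w x) {A B : Set V} (h : A ⊆ B) :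
    weightOf w A ≤ weightOf w B :=
  Finset.sum_le_sum fun x _ => Set.indicator_le_indicator_of_subset h hw x

theorem le_weightOf {w : V → ℝ} (hw : ∀ x, 0 ≤ w x) {A : Set V} {x : V} (h : x ∈ A) :
    w x ≤ weightOf w A := by
  rw [weightOf]
  refine le_trans ?_ (Finset.single_le_sum (f := fun y => A.indicator w y)
    (fun y _ => Set.indicator_nonneg (fun x _ => hw x) y) (Finset.mem_univ x))
  simp [h]

theorem weightOf_union_le {w : V → ℝ} (hw : ∀ x, 0 ≤ w x) (A B : Set V) :
    weightOf w (A ∪ B) ≤ weightOf w A + weightOf w B := by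
  rw [weightOf, weightOf, weightOf, ← Finset.sum_add_distrib]
  refine Finset.sum_le_sum fun x _ => ?_
  have := hw x
  by_cases h1 : x ∈ A <;> by_cases h2 : x ∈ B <;> simp [h1, h2, this]

theorem weightOf_union_of_disjoint (w : V → ℝ) {A B : Set V} (h : Disjoint A B) :
    weightOf w (A ∪ B) = weightOf w A + weightOf w B := by
  rw [weightOf, weightOf, weightOf, ← Finset.sum_add_distrib]
  refine Finset.sum_congr rfl fun x _ => ?_
  rw [Set.indicator_union_of_disjoint h]

theorem weightOf_biUnion_le {ι : Type*} {w : V → ℝ} (hw : ∀ x, 0 ≤ w x) (s : Finset ι)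
    {A : Set V} (B : ι → Set V) (h : ∀ x ∈ A, ∃ i ∈ s, x ∈ B i) :
    weightOf w A ≤ ∑ i ∈ s, weightOf w (B i) := by
  simp only [weightOf]
  rw [Finset.sum_comm]
  refine Finset.sum_le_sum fun x _ => ?_
  have hn : ∀ i ∈ s, 0 ≤ (B i).indicator w x :=
    fun i _ => Set.indicator_nonneg (fun x _ => hw x) x
  by_cases hx : x ∈ A
  · obtain ⟨i, hi, hxi⟩ := h x hx
    refine le_trans ?_ (Finset.single_le_sum hn hi)
    simp [hx, hxi]
  · simpa [hx] using Finset.sum_nonneg hn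

theorem weightOf_le_mul {w w' : V → ℝ} {A : Set V} {C : ℝ}
    (h : ∀ x ∈ A, w x ≤ C * w' x) : weightOf w A ≤ C * weightOf w' A := by
  rw [weightOf, weightOf, Finset.mul_sum]
  refine Finset.sum_le_sum fun x _ => ?_
  by_cases hx : x ∈ A
  · simpa [hx] using h x hx
  · simp [hx]

theorem weightOf_const_mul (w : V → ℝ) (A : Set V) (C : ℝ) :
    weightOf (fun x => C * w x) A = C * weightOf w A := by
  classical
  simp only [weightOf_eq_sum_filter, Finset.mul_sum]

theorem weightOf_image {φ : V → W} (hφ : Function.Injective φ) (w : W → ℝ) (A : Set V) :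
    weightOf w (φ '' A) = weightOf (fun x => w (φ x)) A := by
  classical
  rw [weightOf_eq_sum_filter, weightOf_eq_sum_filter,
    ← Finset.sum_image (f := w) (g := φ) hφ.injOn]
  congr 1
  ext y
  simp

/-- Double counting: a weighted sum over pairs of related elements. -/
theorem sum_weightOf_le {W : Type*} {w : V → ℝ} (hw : ∀ x, 0 ≤ w x) (s : Finset W) (A : Set V)
    (r : W → V → Prop) {N : ℝ} (hN : ∀ x ∈ A, ({v | v ∈ s ∧ r v x}.ncard : ℝ) ≤ N) :
    ∑ v ∈ s, weightOf w {x | x ∈ A ∧ r v x} ≤ N * weightOf w A := by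
  classical
  simp only [weightOf]
  rw [Finset.sum_comm, Finset.mul_sum]
  refine Finset.sum_le_sum fun x _ => ?_
  by_cases hx : x ∈ A
  · have := hN x hx
    have h2 : {v | v ∈ s ∧ r v x} = ((s.filter fun v => r v x : Finset W) : Set W) := by
      ext; simp
    rw [h2, Set.ncard_coe_finset] at this
    simp only [Set.indicator_apply, Set.mem_ofPred_eq, hx, true_and, if_true]
    rw [← Finset.sum_filter, Finset.sum_const, nsmul_eq_mul]
    exact mul_le_mul_of_nonneg_right this (hw x)
  · simp [hx]

/-- Exchanging the order of summation for a relation. -/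
theorem weightOf_weightOf_comm (A : Set V) (B : Set W) (r : V → W → Prop) (g : V → W → ℝ) :
    weightOf (fun x => weightOf (g x) {y | y ∈ B ∧ r x y}) A =
      weightOf (fun y => weightOf (fun x => g x y) {x | x ∈ A ∧ r x y}) B := by
  classical
  simp only [weightOf, Set.indicator_apply, Set.mem_ofPred_eq]
  have h1 : ∀ x : V, (if x ∈ A then ∑ y, (if y ∈ B ∧ r x y then g x y else 0) else 0) =
      ∑ y, if x ∈ A ∧ y ∈ B ∧ r x y then g x y else 0 := fun x => by
    by_cases hx : x ∈ A <;> simp [hx]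
  have h2 : ∀ y : W, (if y ∈ B then ∑ x, (if x ∈ A ∧ r x y then g x y else 0) else 0) =
      ∑ x, if x ∈ A ∧ y ∈ B ∧ r x y then g x y else 0 := fun y => by
    by_cases hy : y ∈ B <;> simp [hy]
  simp only [h1, h2]
  exact Finset.sum_comm

theorem weightOf_one (A : Set V) : weightOf (fun _ => (1 : ℝ)) A = A.ncard := by
  classical
  rw [weightOf_eq_sum_filter, Finset.sum_const, nsmul_eq_mul, mul_one,
    ← Set.ncard_coe_finset]
  congr 2
  ext; simp

end WeightOf

/-! ### Infima in finite posets and in links. -/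

section Infima

variable {X : Type u} [PartialOrder X]

theorem exists_infima [Fintype X] {A : Set X} {e : X} (he : e ∈ lowerBounds A) :
    ∃ v ∈ infima A, e ≤ v := by
  obtain ⟨v, hv, hm⟩ := (Set.toFinite {c : X | c ∈ lowerBounds A}).exists_le_maximal he
  exact ⟨v, hm, hv⟩

theorem infima_eq_of_isBot {A : Set X} {e : X} (he : IsBot e) (h : e ∈ infima A) :
    infima A = {e} := by
  ext c
  refine ⟨fun hc => ?_, fun hc => by rw [Set.mem_singleton_iff.1 hc]; exact h⟩
  exact le_antisymm (h.2 hc.1 (he c)) (he c)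

/-- This turns a pair with infimum `v` into a pair of the link of `v` that meets only in its empty
face, which is what the no-intersection hypergraph of the link records. -/
theorem mem_infima_link {v x y : X} (hx : v ≤ x) (hy : v ≤ y) (h : v ∈ infima {x, y}) :
    (⟨v, le_rfl⟩ : Link v) ∈ infima {(⟨x, hx⟩ : Link v), ⟨y, hy⟩} := by
  refine ⟨?_, fun c hc _ => ?_⟩
  · rintro _ (rfl | rfl)
    · exact hx
    · exact hy
  · refine h.2 (y := c.1) ?_ c.2
    rintro _ (rfl | rfl)
    · exact hc (Or.inl rfl)
    · exact hc (Or.inr rfl)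

end Infima

/-! ### Graded posets -/

section Graded

variable {X : Type u} [PartialOrder X] [GradeOrder ℤ X]

theorem dim_strictMono : StrictMono (dim : X → ℤ) := grade_strictMono

theorem dim_mono : Monotone (dim : X → ℤ) := dim_strictMono.monotone

theorem eq_of_le_of_dim_eq {x y : X} (h : x ≤ y) (hd : dim x = dim y) : x = y := by
  by_contra hne
  exact (dim_strictMono (lt_of_le_of_ne h hne)).ne hd

/-- A maximal face between `x` and `z` of dimension at most `j` has dimension exactly `j`: otherwise
some face covering it lies below `z`, and its dimension is only one larger. -/
theorem exists_dim_eq [Fintype X] {x z : X} (h : x ≤ z) {j : ℤ} (h1 : dim x ≤ j)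
    (h2 : j ≤ dim z) : ∃ y, dim y = j ∧ x ≤ y ∧ y ≤ z := by
  classical
  have hfin : {y : X | x ≤ y ∧ y ≤ z ∧ dim y ≤ j}.Finite := Set.toFinite _
  obtain ⟨y, hy⟩ := hfin.exists_maximal ⟨x, le_rfl, h, h1⟩
  refine ⟨y, ?_, hy.prop.1, hy.prop.2.1⟩
  by_contra hne
  have hlt : dim y < j := lt_of_le_of_ne hy.prop.2.2 hne
  have hyz : y < z := lt_of_le_of_ne hy.prop.2.1 (by rintro rfl; omega)
  obtain ⟨t, htz⟩ := (Set.toFinite {t : X | y < t ∧ t ≤ z}).exists_minimal ⟨z, hyz, le_rfl⟩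
  have hcov : y ⋖ t := ⟨htz.prop.1, fun c h1 h2 =>
    (htz.le_of_le ⟨h1, h2.le.trans htz.prop.2⟩ h2.le).not_gt h2⟩
  have h3 : dim y + 1 = dim t := by
    have := hcov.grade ℤ
    rwa [Order.covBy_iff_add_one_eq] at this
  exact (hy.le_of_ge ⟨hy.prop.1.trans htz.prop.1.le, htz.prop.2, by omega⟩
    htz.prop.1.le).not_gt htz.prop.1

variable (X) in
theorem betweenCounts_bddAbove [Fintype X] (i j k : ℤ) : BddAbove (betweenCounts X i j k) :=
  ⟨Fintype.card X, by
    rintro n ⟨x, z, -, -, -, rfl⟩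
    rw [← Nat.card_eq_fintype_card]
    exact Set.ncard_le_card _⟩

/-- The number of `j`-faces between `x` and `z`. -/
noncomputable def btw (x z : X) (j : ℤ) : ℕ := {y : X | dim y = j ∧ x ≤ y ∧ y ≤ z}.ncard

theorem btw_le_Fmax [Fintype X] {x z : X} (h : x ≤ z) (j : ℤ) :
    btw x z j ≤ Fmax X (dim x) j (dim z) :=
  le_csSup (betweenCounts_bddAbove X _ _ _) ⟨x, z, rfl, rfl, h, rfl⟩

theorem Fmin_le_btw {x z : X} (h : x ≤ z) (j : ℤ) : Fmin X (dim x) j (dim z) ≤ btw x z j :=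
  Nat.sInf_le ⟨x, z, rfl, rfl, h, rfl⟩

theorem btw_pos [Fintype X] {x z : X} (h : x ≤ z) {j : ℤ} (h1 : dim x ≤ j)
    (h2 : j ≤ dim z) : 0 < btw x z j := by
  obtain ⟨y, hy⟩ := exists_dim_eq h h1 h2
  exact (Set.ncard_pos (Set.toFinite _)).2 ⟨y, hy⟩

theorem Fmin_pos [Fintype X] {x z : X} (h : x ≤ z) {j : ℤ} (h1 : dim x ≤ j)
    (h2 : j ≤ dim z) : 0 < Fmin X (dim x) j (dim z) := by
  have hne : (betweenCounts X (dim x) j (dim z)).Nonempty := ⟨_, x, z, rfl, rfl, h, rfl⟩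
  obtain ⟨x', z', hx, hz, hxz, hn⟩ := Nat.sInf_mem hne
  rw [Fmin, hn]
  exact btw_pos hxz (by omega) (by omega)

theorem Fmax_le_mul_Fmin [Fintype X] {d : ℕ} {L : ℝ} (hL : lowerIrregularity X d ≤ L)
    {x z : X} (h : x ≤ z) {j : ℤ} (h0 : -1 ≤ dim x) (h1 : dim x ≤ j) (h2 : j ≤ dim z)
    (h3 : dim z ≤ d) :
    (Fmax X (dim x) j (dim z) : ℝ) ≤ L * Fmin X (dim x) j (dim z) := by
  have hpos : (0 : ℝ) < Fmin X (dim x) j (dim z) := by exact_mod_cast Fmin_pos h h1 h2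
  rw [← div_le_iff₀ hpos]
  refine le_trans ?_ hL
  rw [lowerIrregularity]
  refine le_csSup ?_ ⟨dim x, j, dim z, h0, h1, h2, h3, rfl⟩
  -- A real `sSup` says nothing about an unbounded set; here boundedness holds because only finitely
  -- many triples of dimensions occur.
  have : {c : ℝ | ∃ i j k : ℤ, -1 ≤ i ∧ i ≤ j ∧ j ≤ k ∧ k ≤ d ∧
      c = (Fmax X i j k : ℝ) / (Fmin X i j k : ℝ)} ⊆
      (fun p : ℤ × ℤ × ℤ => (Fmax X p.1 p.2.1 p.2.2 : ℝ) / (Fmin X p.1 p.2.1 p.2.2 : ℝ)) ''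
        (Set.Icc (-1 : ℤ) d ×ˢ Set.Icc (-1 : ℤ) d ×ˢ Set.Icc (-1 : ℤ) d) := by
    rintro c ⟨i, j, k, h1, h2, h3, h4, rfl⟩
    exact ⟨(i, j, k), ⟨⟨h1, h2.trans (h3.trans h4)⟩, ⟨h1.trans h2, h3.trans h4⟩,
      ⟨h1.trans (h2.trans h3), h4⟩⟩, rfl⟩
  exact (Set.Finite.subset (((Set.finite_Icc _ _).prod
    ((Set.finite_Icc _ _).prod (Set.finite_Icc _ _))).image _) this).bddAbove

/-- Counting flags of faces of dimensions `i` and `j` below `y` in two ways. -/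
theorem sum_btw_comm [Fintype X] {e y : X} (i j : ℤ) (he : IsBot e) :
    weightOf (fun x : X => (btw e x i : ℝ)) {x | dim x = j ∧ x ≤ y} =
      weightOf (fun u : X => (btw u y j : ℝ)) {u | dim u = i ∧ u ≤ y} := by
  have := weightOf_weightOf_comm {x : X | dim x = j ∧ x ≤ y} {u : X | dim u = i ∧ u ≤ y}
    (fun x u => u ≤ x) (fun _ _ => (1 : ℝ))
  simp only [weightOf_one] at this
  have key : ∀ (f g : X → ℝ) (A : Set X), (∀ x ∈ A, f x = g x) →
      weightOf f A = weightOf g A := fun f g A h => by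
    classical
    rw [weightOf_eq_sum_filter, weightOf_eq_sum_filter]
    exact Finset.sum_congr rfl fun x hx => h x (by simpa using hx)
  rw [key _ (fun x : X => (btw e x i : ℝ)) _ fun x hx => ?_,
    key _ (fun u : X => (btw u y j : ℝ)) {u | dim u = i ∧ u ≤ y} fun x hx => ?_] at this
  · exact this
  · rw [btw]
    congr 2
    ext z
    simp only [Set.mem_ofPred_eq]
    tauto
  · rw [btw]
    congr 2
    ext z
    simp only [Set.mem_ofPred_eq]
    have := he z
    have : z ≤ x → z ≤ y := fun h => h.trans hx.2
    tauto

end Graded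

/-! ### Comparison of the weights of a poset and of its links. -/

section WeightComparison

variable {X : Type u} [PartialOrder X] [GradeOrder ℤ X] {d : ℕ}

theorem IsDPoset.neg_one_le_dim (hX : IsDPoset X d) (x : X) : -1 ≤ dim x := by
  obtain ⟨e, he, h⟩ := hX.empty_face
  rw [← he]
  exact dim_mono (h x)

theorem IsDPoset.isBot_of_dim_eq (hX : IsDPoset X d) {x : X} (hx : dim x = -1) : IsBot x := by
  obtain ⟨e, he, h⟩ := hX.empty_face
  rw [← eq_of_le_of_dim_eq (h x) (he.trans hx.symm)]
  exact h

theorem IsDPoset.dim_le (hX : IsDPoset X d) (x : X) : dim x ≤ d := by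
  obtain ⟨y, hy, h⟩ := hX.pure x
  exact hy ▸ dim_mono h

theorem btw_eq_of_isBot {e y : X} (he : IsBot e) (j : ℤ) :
    btw e y j = {x' : X | dim x' = j ∧ x' ≤ y}.ncard := by
  rw [btw]
  congr 1
  ext z
  have := he z
  simp only [Set.mem_ofPred_eq]
  tauto

variable [Fintype X] {w : X → ℝ} {L : ℝ} {F : ℕ}

/-- Counting flags below a `d`-face bounds products of face numbers by each other. -/
theorem flag_count (hX : IsDPoset X d) {e u x : X} (he : IsBot e) :
    ((Fmin X (-1) (dim x) d : ℝ) * Fmin X (-1) (dim u) (dim x) ≤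
      Fmax X (-1) (dim u) d * Fmax X (dim u) (dim x) d) ∧
    ((Fmin X (-1) (dim u) d : ℝ) * Fmin X (dim u) (dim x) d ≤
      Fmax X (-1) (dim x) d * Fmax X (-1) (dim u) (dim x)) := by
  obtain ⟨y, hy, hxy⟩ := hX.pure x
  have hde : dim e = -1 := by
    obtain ⟨e', he', h⟩ := hX.empty_face
    exact le_antisymm (he' ▸ dim_mono (he e')) (hX.neg_one_le_dim e)
  -- Both inequalities estimate this one flag count below `y`, from below by one side and from above
  -- by the other.
  have hcount := sum_btw_comm (y := y) (dim u) (dim x) he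
  have hset : ∀ i : ℤ, (btw e y i : ℝ) = weightOf (fun _ => (1 : ℝ)) {x' : X | dim x' = i ∧ x' ≤ y} := by
    intro i
    rw [weightOf_one, btw]
    congr 2
    ext z
    have := he z
    simp only [Set.mem_ofPred_eq]
    tauto
  have hub : ∀ (f : X → ℝ) (A : Set X) (C : ℝ), (∀ x ∈ A, f x ≤ C) →
      weightOf f A ≤ C * weightOf (fun _ => (1 : ℝ)) A := fun f A C h =>
    weightOf_le_mul fun x hx => by simpa using h x hx
  have hlb : ∀ (f : X → ℝ) (A : Set X) (C : ℝ), (∀ x ∈ A, C ≤ f x) →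
      C * weightOf (fun _ => (1 : ℝ)) A ≤ weightOf f A := fun f A C h => by
    rw [← weightOf_const_mul, ← one_mul (weightOf f A)]
    exact weightOf_le_mul fun x hx => by simpa using h x hx
  have hmaxmin : ∀ i : ℤ, ((Fmin X (-1) i d : ℝ) ≤ btw e y i) ∧ ((btw e y i : ℝ) ≤ Fmax X (-1) i d) := by
    intro i
    have h1 := Fmin_le_btw (he y) i
    have h2 := btw_le_Fmax (he y) i
    rw [hde, hy] at h1 h2
    exact ⟨by exact_mod_cast h1, by exact_mod_cast h2⟩
  have hA1 := hub (fun x' : X => (btw e x' (dim u) : ℝ)) {x' | dim x' = dim x ∧ x' ≤ y}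
    (Fmax X (-1) (dim u) (dim x)) fun x' hx' => by
      have := btw_le_Fmax (he x') (dim u)
      rw [hde, hx'.1] at this
      exact_mod_cast this
  have hA2 := hlb (fun x' : X => (btw e x' (dim u) : ℝ)) {x' | dim x' = dim x ∧ x' ≤ y}
    (Fmin X (-1) (dim u) (dim x)) fun x' hx' => by
      have := Fmin_le_btw (he x') (dim u)
      rw [hde, hx'.1] at this
      exact_mod_cast this
  have hB1 := hub (fun u' : X => (btw u' y (dim x) : ℝ)) {u' | dim u' = dim u ∧ u' ≤ y}
    (Fmax X (dim u) (dim x) d) fun u' hu' => by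
      have := btw_le_Fmax hu'.2 (dim x)
      rw [hu'.1, hy] at this
      exact_mod_cast this
  have hB2 := hlb (fun u' : X => (btw u' y (dim x) : ℝ)) {u' | dim u' = dim u ∧ u' ≤ y}
    (Fmin X (dim u) (dim x) d) fun u' hu' => by
      have := Fmin_le_btw hu'.2 (dim x)
      rw [hu'.1, hy] at this
      exact_mod_cast this
  rw [← hset] at hA1 hA2 hB1 hB2
  constructor
  · calc (Fmin X (-1) (dim x) d : ℝ) * Fmin X (-1) (dim u) (dim x)
        ≤ btw e y (dim x) * Fmin X (-1) (dim u) (dim x) := by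
          gcongr; exact_mod_cast (hmaxmin _).1
      _ ≤ Fmax X (dim u) (dim x) d * btw e y (dim u) := by linarith
      _ ≤ Fmax X (dim u) (dim x) d * Fmax X (-1) (dim u) d := by
          gcongr; exact_mod_cast (hmaxmin _).2
      _ = _ := by ring
  · calc (Fmin X (-1) (dim u) d : ℝ) * Fmin X (dim u) (dim x) d
        ≤ btw e y (dim u) * Fmin X (dim u) (dim x) d := by
          gcongr; exact_mod_cast (hmaxmin _).1
      _ ≤ Fmax X (-1) (dim u) (dim x) * btw e y (dim x) := by linarith
      _ ≤ Fmax X (-1) (dim u) (dim x) * Fmax X (-1) (dim x) d := by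
          gcongr; exact_mod_cast (hmaxmin _).2
      _ = _ := by ring

/-- The total weight of the top faces above `x`. -/
noncomputable def topWeight (d : ℕ) (w : X → ℝ) (x : X) : ℝ := weightOf w {y : X | dim y = d ∧ x ≤ y}

theorem topWeight_pos (hX : IsDPoset X d) (hw : ∀ x, 0 < w x) (x : X) : 0 < topWeight d w x := by
  obtain ⟨y, hy, hxy⟩ := hX.pure x
  exact (hw y).trans_le (le_weightOf (fun x => (hw x).le) ⟨hy, hxy⟩)

/-- Properness writes `w x` as a sum over the top faces `y ≥ x` of `w y` divided by a face number,
and that number lies between `Fmin` and `Fmax`. The next lemma is the same estimate in a link. -/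
theorem weight_mul_bounds (hX : IsDPoset X d) (hw : IsProperWeight d w) (x : X) :
    w x * Fmin X (-1) (dim x) d ≤ topWeight d w x ∧
      topWeight d w x ≤ w x * Fmax X (-1) (dim x) d := by
  obtain ⟨e, hde, he⟩ := hX.empty_face
  have hpos : ∀ y : X, dim y = d → x ≤ y → (0 : ℝ) < btw e y (dim x) := fun y hy hxy => by
    exact_mod_cast btw_pos (he y) (dim_mono (he x)) (dim_mono hxy)
  have hwx := hw.proper x
  constructor
  · rw [hwx, mul_comm, topWeight, ← one_mul (weightOf w _), ← weightOf_const_mul]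
    refine weightOf_le_mul fun y hy => ?_
    rw [← btw_eq_of_isBot (e := e) he, one_mul, mul_div_assoc', div_le_iff₀ (hpos y hy.1 hy.2),
      mul_comm]
    have := Fmin_le_btw (he y) (dim x)
    rw [hde, hy.1] at this
    exact mul_le_mul_of_nonneg_left (by exact_mod_cast this) (hw.pos y).le
  · rw [hwx, mul_comm, topWeight]
    refine weightOf_le_mul fun y hy => ?_
    rw [← btw_eq_of_isBot (e := e) he, mul_div_assoc', le_div_iff₀ (hpos y hy.1 hy.2),
      mul_comm]
    have := btw_le_Fmax (he y) (dim x)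
    rw [hde, hy.1] at this
    exact mul_le_mul_of_nonneg_right (by exact_mod_cast this) (hw.pos y).le

theorem linkWeight_mul_bounds (hX : IsDPoset X d) (hw : IsProperWeight d w) (u : X) (x : Link u) :
    topWeight d w u * linkWeight d w u x * Fmin X (dim u) (dim x.1) d ≤ topWeight d w x.1 ∧
      topWeight d w x.1 ≤ topWeight d w u * linkWeight d w u x * Fmax X (dim u) (dim x.1) d := by
  have hpos : ∀ y : X, dim y = d → x.1 ≤ y → (0 : ℝ) < btw u y (dim x.1) := fun y hy hxy => by
    exact_mod_cast btw_pos (x.2.trans hxy) (dim_mono x.2) (dim_mono hxy)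
  have hl : topWeight d w u * linkWeight d w u x =
      weightOf (fun y : X => w y / (btw u y (dim x.1) : ℝ)) {y : X | dim y = d ∧ x.1 ≤ y} := by
    rw [linkWeight, ← topWeight, mul_inv_cancel_left₀ (topWeight_pos hX hw.pos u).ne']
    rfl
  rw [hl]
  constructor
  · rw [mul_comm, topWeight, ← one_mul (weightOf w _), ← weightOf_const_mul]
    refine weightOf_le_mul fun y hy => ?_
    rw [one_mul, mul_div_assoc', div_le_iff₀ (hpos y hy.1 hy.2), mul_comm]
    have := Fmin_le_btw (x.2.trans hy.2) (dim x.1)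
    rw [hy.1] at this
    exact mul_le_mul_of_nonneg_left (by exact_mod_cast this) (hw.pos y).le
  · rw [mul_comm, topWeight]
    refine weightOf_le_mul fun y hy => ?_
    rw [mul_div_assoc', le_div_iff₀ (hpos y hy.1 hy.2), mul_comm]
    have := btw_le_Fmax (x.2.trans hy.2) (dim x.1)
    rw [hy.1] at this
    exact mul_le_mul_of_nonneg_right (by exact_mod_cast this) (hw.pos y).le

theorem linkWeight_nonneg (hX : IsDPoset X d) (hw : IsProperWeight d w) (u : X) (x : Link u) :
    0 ≤ linkWeight d w u x := by
  refine mul_nonneg (inv_nonneg.2 (topWeight_pos hX hw.pos u).le) (weightOf_nonneg (fun y => ?_) _)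
  exact div_nonneg (hw.pos y).le (Nat.cast_nonneg _)

/-- The weights of `X` and of its links are comparable. -/
theorem weight_comparison (hX : IsDPoset X d) (hw : IsProperWeight d w)
    (hL : lowerIrregularity X d ≤ L) (u : X) (x : Link u)
    (hF : Fmax X (-1) (dim u) (dim x.1) ≤ F) :
    w u * linkWeight d w u x ≤ L ^ 3 * w x.1 ∧
      w x.1 ≤ L ^ 3 * F * (w u * linkWeight d w u x) := by
  obtain ⟨e, hde, he⟩ := hX.empty_face
  obtain ⟨y, hy, hxy⟩ := hX.pure x.1
  have hux := dim_mono x.2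
  have heu := dim_mono (he u)
  have hxd := hX.dim_le x.1
  have hey := he y
  have huy := x.2.trans hxy
  obtain ⟨hc1, hc2⟩ := flag_count hX (e := e) (u := u) (x := x.1) he
  obtain ⟨hu1, hu2⟩ := weight_mul_bounds hX hw u
  obtain ⟨hx1, hx2⟩ := weight_mul_bounds hX hw x.1
  obtain ⟨hl1, hl2⟩ := linkWeight_mul_bounds hX hw u x
  have hT := topWeight_pos hX hw.pos u
  have hTx := topWeight_pos hX hw.pos x.1
  have hln := linkWeight_nonneg hX hw u x
  have hwx := hw.pos x.1
  have hwu := hw.pos u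
  have p1 := Fmin_pos (he y) (j := dim x.1) (by omega) (by omega)
  have p2 := Fmin_pos (he y) (j := dim u) (by omega) (by omega)
  have p3 := Fmin_pos huy (j := dim x.1) (by omega) (by omega)
  have p4 := Fmin_pos (he x.1) (j := dim u) (by omega) (by omega)
  have q1 := Fmax_le_mul_Fmin hL (he y) (j := dim x.1) (by omega) (by omega) (by omega) (by omega)
  have q2 := Fmax_le_mul_Fmin hL (he y) (j := dim u) (by omega) (by omega) (by omega) (by omega)
  have q3 := Fmax_le_mul_Fmin hL huy (j := dim x.1) (by omega) (by omega) (by omega) (by omega)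
  rw [hde, hy] at p1 p2 q1 q2
  rw [hde] at p4
  rw [hy] at p3 q3
  have m1 : Fmin X (-1) (dim x.1) d ≤ Fmax X (-1) (dim x.1) d := by
    have h1 := Fmin_le_btw hey (dim x.1)
    have h2 := btw_le_Fmax hey (dim x.1)
    rw [hde, hy] at h1 h2
    exact h1.trans h2
  have hF' : (Fmax X (-1) (dim u) (dim x.1) : ℝ) ≤ F := by exact_mod_cast hF
  have p1' : (1 : ℝ) ≤ Fmin X (-1) (dim x.1) d := by exact_mod_cast p1
  have p2' : (1 : ℝ) ≤ Fmin X (-1) (dim u) d := by exact_mod_cast p2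
  have p3' : (1 : ℝ) ≤ Fmin X (dim u) (dim x.1) d := by exact_mod_cast p3
  have p4' : (1 : ℝ) ≤ Fmin X (-1) (dim u) (dim x.1) := by exact_mod_cast p4
  have m1' : (Fmin X (-1) (dim x.1) d : ℝ) ≤ Fmax X (-1) (dim x.1) d := by exact_mod_cast m1
  have hb40 : (0 : ℝ) ≤ Fmax X (-1) (dim u) (dim x.1) := Nat.cast_nonneg _
  -- Below, `a` stands for minimal and `b` for maximal counts. Index 1 counts `dim x`-faces below a
  -- `d`-face, 2 counts `dim u`-faces below a `d`-face, 3 counts `dim x`-faces between a `dim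
  -- u`-face and a `d`-face, and 4 counts `dim u`-faces below a `dim x`-face.
  generalize (Fmin X (-1) (dim x.1) d : ℝ) = a1 at *
  generalize (Fmin X (-1) (dim u) d : ℝ) = a2 at *
  generalize (Fmin X (dim u) (dim x.1) d : ℝ) = a3 at *
  generalize (Fmin X (-1) (dim u) (dim x.1) : ℝ) = a4 at *
  generalize (Fmax X (-1) (dim x.1) d : ℝ) = b1 at *
  generalize (Fmax X (-1) (dim u) d : ℝ) = b2 at *
  generalize (Fmax X (dim u) (dim x.1) d : ℝ) = b3 at *
  generalize (Fmax X (-1) (dim u) (dim x.1) : ℝ) = b4 at *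
  generalize topWeight d w u = T at *
  generalize topWeight d w x.1 = Tx at *
  generalize linkWeight d w u x = l at *
  generalize w u = wu at *
  generalize w x.1 = wx at *
  have hL0 : 0 < L := by
    by_contra h
    nlinarith
  have hb1 : 0 < b1 := by linarith
  have hb2 : 0 < b2 := by
    by_contra h
    nlinarith [mul_pos hwu (by linarith : 0 < a2)]
  have hb3 : 0 < b3 := by
    by_contra h
    nlinarith [mul_nonneg hT.le hln]
  have hu0 : 0 ≤ wu * l := by positivity
  constructor
  · have h1 : wu * l * (a2 * a3) ≤ wx * b1 := by
      calc wu * l * (a2 * a3) = wu * a2 * (l * a3) := by ring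
        _ ≤ T * (l * a3) := by gcongr
        _ = T * l * a3 := by ring
        _ ≤ Tx := hl1
        _ ≤ wx * b1 := hx2
    -- Each factor `L` pays for replacing one maximal count by the minimal one; the flag count links
    -- `a1 * a4` to `b2 * b3`.
    have h2 : b1 ≤ L ^ 3 * (a2 * a3) := by
      calc b1 ≤ L * a1 := q1
        _ ≤ L * (a1 * a4) := by
          gcongr
          nlinarith
        _ ≤ L * (b2 * b3) := by gcongr
        _ ≤ L * ((L * a2) * (L * a3)) := by gcongr
        _ = _ := by ring
    have h3 : wu * l * (a2 * a3) ≤ (L ^ 3 * wx) * (a2 * a3) := by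
      calc _ ≤ wx * b1 := h1
        _ ≤ wx * (L ^ 3 * (a2 * a3)) := by gcongr
        _ = _ := by ring
    exact le_of_mul_le_mul_right h3 (by positivity)
  · have h1 : wx * a1 ≤ wu * l * (b2 * b3) := by
      calc wx * a1 ≤ Tx := hx1
        _ ≤ T * l * b3 := hl2
        _ ≤ wu * b2 * l * b3 := by gcongr
        _ = _ := by ring
    have h2 : b2 * b3 ≤ L ^ 3 * F * a1 := by
      calc b2 * b3 ≤ (L * a2) * (L * a3) := by gcongr
        _ = L ^ 2 * (a2 * a3) := by ring
        _ ≤ L ^ 2 * (b1 * b4) := by gcongr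
        _ ≤ L ^ 2 * ((L * a1) * F) := by gcongr
        _ = _ := by ring
    have h3 : wx * a1 ≤ L ^ 3 * F * (wu * l) * a1 := by
      calc _ ≤ _ := h1
        _ ≤ wu * l * (L ^ 3 * F * a1) := by gcongr
        _ = _ := by ring
    exact le_of_mul_le_mul_right h3 (by linarith)

/-- Each `d`-face above `u` shares its weight equally among the `j`-faces between `u` and itself.
Only an inequality is claimed because there may be no such `j`-face. -/
theorem weightOf_linkWeight_le (hX : IsDPoset X d) (hw : IsProperWeight d w) (u : X) (j : ℤ) :
    weightOf (linkWeight d w u) {x : Link u | dim x.1 = j} ≤ 1 := by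
  have hT := topWeight_pos hX hw.pos u
  have h1 : weightOf (linkWeight d w u) {x : Link u | dim x.1 = j} ≤
      (topWeight d w u)⁻¹ * weightOf (fun x : Link u =>
        weightOf (fun y : X => w y / (btw u y j : ℝ))
          {y : X | y ∈ {y | dim y = d ∧ u ≤ y} ∧ x.1 ≤ y}) {x : Link u | dim x.1 = j} := by
    refine weightOf_le_mul fun x hx => ?_
    have hx' : dim x.1 = j := hx
    have : {y : X | y ∈ {y | dim y = d ∧ u ≤ y} ∧ x.1 ≤ y} = {y | dim y = d ∧ x.1 ≤ y} := by
      ext y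
      have : x.1 ≤ y → u ≤ y := x.2.trans
      simp only [Set.mem_ofPred_eq]
      tauto
    rw [this, ← hx']
    exact le_rfl
  refine h1.trans ?_
  rw [weightOf_weightOf_comm (r := fun (x : Link u) (y : X) => x.1 ≤ y), inv_mul_le_iff₀ hT,
    mul_one, topWeight, ← one_mul (weightOf w _)]
  refine weightOf_le_mul fun y hy => ?_
  have h2 : ∀ (c : ℝ) (A : Set (Link u)), weightOf (fun _ => c) A = c * A.ncard := fun c A => by
    rw [← weightOf_one, ← weightOf_const_mul]
    simp
  have h3 : ({x : Link u | x ∈ {x : Link u | dim x.1 = j} ∧ x.1 ≤ y}.ncard) = btw u y j := by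
    rw [btw, ← Set.ncard_image_of_injective _ Subtype.val_injective]
    congr 1
    ext z
    constructor
    · rintro ⟨z, ⟨h, h'⟩, rfl⟩
      exact ⟨h, z.2, h'⟩
    · rintro ⟨h, h', h''⟩
      exact ⟨⟨z, h'⟩, ⟨h, h''⟩, rfl⟩
  rw [h2, h3, one_mul]
  rcases Nat.eq_zero_or_pos (btw u y j) with h | h
  · simp [h, (hw.pos y).le]
  · rw [div_mul_cancel₀]
    exact_mod_cast h.ne'

end WeightComparison

/-- The numerical facts about a weighted poset, up to dimension `n`, used by the expansion
argument: weights in links are comparable to weights, and faces have boundedly many subfaces. -/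
structure WeightBounds (X : Type u) [PartialOrder X] [GradeOrder ℤ X] [Fintype X] (d : ℕ)
    (w : X → ℝ) (n : ℤ) (F : ℕ) (D : ℝ) : Prop where
  one_le : 1 ≤ D
  pos : ∀ x, 0 < w x
  neg_one_le : ∀ x : X, -1 ≤ dim x
  exists_bot : ∃ e : X, dim e = -1 ∧ ∀ x : X, e ≤ x
  ncard_le : ∀ (x : X), dim x ≤ n → ∀ i : ℤ, {v : X | dim v = i ∧ v ≤ x}.ncard ≤ F
  link_le : ∀ (u : X) (x : Link u), dim x.1 ≤ n → w u * linkWeight d w u x ≤ D * w x.1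
  le_link : ∀ (u : X) (x : Link u), dim x.1 ≤ n → w x.1 ≤ D * (w u * linkWeight d w u x)
  link_nonneg : ∀ (u : X) (x : Link u), 0 ≤ linkWeight d w u x
  above_le : ∀ (u : X) (j : ℤ), j ≤ n → weightOf w {x : X | dim x = j ∧ u ≤ x} ≤ D * w u

/-- One constant serves every comparison; the `+ 1` keeps it at least `1` even for `F = 0`. The
bound on the faces above `u` combines the weight comparison with the total link weight being at most
`1`. -/
theorem weightBounds {X : Type u} [PartialOrder X] [GradeOrder ℤ X] [Fintype X] {d : ℕ}
    {w : X → ℝ} {L : ℝ} {F : ℕ} (hX : IsDPoset X d) (hw : IsProperWeight d w) (hL1 : 1 ≤ L)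
    (hL : lowerIrregularity X d ≤ L) {n : ℤ}
    (hF : ∀ i j : ℤ, -1 ≤ i → i ≤ j → j ≤ n → Fmax X (-1) i j ≤ F) :
    WeightBounds X d w n F (L ^ 3 * (F + 1)) := by
  obtain ⟨e, hde, he⟩ := hX.empty_face
  have hL3 : 1 ≤ L ^ 3 := one_le_pow₀ hL1
  have hF0 : (0 : ℝ) ≤ F := Nat.cast_nonneg F
  have hle : ∀ (u : X) (x : Link u), dim x.1 ≤ n →
      w x.1 ≤ L ^ 3 * (F + 1) * (w u * linkWeight d w u x) := fun u x hx => by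
    have hnn : 0 ≤ w u * linkWeight d w u x :=
      mul_nonneg (hw.pos u).le (linkWeight_nonneg hX hw u x)
    refine (weight_comparison hX hw hL u x
      (hF _ _ (hX.neg_one_le_dim u) (dim_mono x.2) hx)).2.trans ?_
    gcongr
    linarith
  refine ⟨by nlinarith, hw.pos, hX.neg_one_le_dim, hX.empty_face, fun x hx i => ?_,
    fun u x hx => ?_, hle, linkWeight_nonneg hX hw, fun u j hj => ?_⟩
  · rw [← btw_eq_of_isBot (e := e) he]
    by_cases hi : -1 ≤ i ∧ i ≤ dim x
    · have := btw_le_Fmax (he x) i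
      rw [hde] at this
      exact this.trans (hF i _ hi.1 hi.2 hx)
    · have : {y : X | dim y = i ∧ e ≤ y ∧ y ≤ x} = ∅ := by
        ext y
        simp only [Set.mem_ofPred_eq, Set.mem_empty_iff_false, iff_false]
        rintro ⟨rfl, -, h⟩
        exact hi ⟨hX.neg_one_le_dim y, dim_mono h⟩
      simp [btw, this]
  · have hwx := hw.pos x.1
    refine (weight_comparison hX hw hL u x
      (hF _ _ (hX.neg_one_le_dim u) (dim_mono x.2) hx)).1.trans ?_
    gcongr
    nlinarith
  · have himg : {x : X | dim x = j ∧ u ≤ x} =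
        (Subtype.val : Link u → X) '' {x : Link u | dim x.1 = j} := by
      ext x
      exact ⟨fun h => ⟨⟨x, h.2⟩, h.1, rfl⟩, by rintro ⟨x, h, rfl⟩; exact ⟨h, x.2⟩⟩
    rw [himg, weightOf_image Subtype.val_injective]
    have h1 : weightOf (fun x : Link u => w x.1) {x : Link u | dim x.1 = j} ≤
        (L ^ 3 * (F + 1) * w u) * weightOf (linkWeight d w u) {x : Link u | dim x.1 = j} :=
      weightOf_le_mul fun x hx => by
        have := hle u x (le_of_eq_of_le hx hj)
        rwa [← mul_assoc] at this
    refine h1.trans ?_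
    have h2 : 0 ≤ L ^ 3 * (F + 1) * w u := by have := hw.pos u; positivity
    simpa using mul_le_mul_of_nonneg_left (weightOf_linkWeight_le hX hw u j) h2

/-! ### Heavy faces, bad faces and confluence of descent. -/

section Heavy

variable {X : Type u} [PartialOrder X] [GradeOrder ℤ X] {m : ℕ} {H : Set X}

/-- A face is bad if two of its heavy admissible subfaces have a non-heavy infimum. -/
def IsBad (P : AbstractIntersectionProfile m) (H : Set X) (a : X) : Prop :=
  ∃ y y' : X, y ∈ H ∧ y' ∈ H ∧ P.Admissible a y ∧ P.Admissible a y' ∧ dim y' ≤ dim y ∧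
    ¬ y' ≤ y ∧ ∃ v ∈ infima {y, y'}, v ∉ H

/-- Passing from a face to a heavy admissible subface. -/
def Desc (P : AbstractIntersectionProfile m) (H : Set X) (a b : X) : Prop :=
  b ∈ H ∧ P.Admissible a b

theorem mem_of_desc {P : AbstractIntersectionProfile m} {x y : X} (hx : x ∈ H)
    (h : Relation.ReflTransGen (Desc P H) x y) : y ∈ H := by
  induction h with
  | refl => exact hx
  | tail _ h _ => exact h.1

theorem le_of_desc {P : AbstractIntersectionProfile m} {x y : X}
    (h : Relation.ReflTransGen (Desc P H) x y) : y ≤ x := by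
  induction h with
  | refl => exact le_rfl
  | tail _ h ih => exact h.2.1.le.trans ih

variable [Fintype X]

/-- `H` is the set of heavy faces generated by the set `A` of `m`-faces, with thresholds given
by `π`. -/
def IsHeavySet (w : X → ℝ) (A : Set X) (m : ℤ) (π : ℤ → ℝ) (H : Set X) : Prop :=
  ∀ x, x ∈ H ↔ (dim x = m ∧ x ∈ A) ∨ (dim x < m ∧ ∃ l : ℤ, dim x < l ∧ l ≤ m ∧
    π (dim x) * w x ≤ π l * weightOf w {y | y ∈ H ∧ dim y = l ∧ x ≤ y})

/-- Heaviness of `x` refers only to faces strictly above `x`, so it can be defined by well-founded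
recursion downwards. -/
theorem exists_isHeavySet (w : X → ℝ) (A : Set X) (m : ℤ) (π : ℤ → ℝ) :
    ∃ H : Set X, IsHeavySet w A m π H := by
  have hwf : WellFounded (fun y x : X => x < y) := wellFounded_gt
  let step : ∀ x : X, (∀ y : X, x < y → Prop) → Prop := fun x ih =>
    (dim x = m ∧ x ∈ A) ∨ (dim x < m ∧ ∃ l : ℤ, dim x < l ∧ l ≤ m ∧
      π (dim x) * w x ≤ π l * weightOf w {y | ∃ h : x < y, ih y h ∧ dim y = l})
  refine ⟨{x | hwf.fix step x}, fun x => ?_⟩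
  have hfix : hwf.fix step x = step x fun y _ => hwf.fix step y := hwf.fix_eq step x
  rw [Set.mem_ofPred_eq, hfix]
  refine or_congr Iff.rfl (and_congr_right fun _ => exists_congr fun l =>
    and_congr_right fun hl => and_congr_right fun _ => ?_)
  have : {y : X | ∃ _ : x < y, hwf.fix step y ∧ dim y = l} =
      {y | y ∈ {x | hwf.fix step x} ∧ dim y = l ∧ x ≤ y} := by
    ext y
    simp only [Set.mem_ofPred_eq]
    constructor
    · rintro ⟨h, h1, h2⟩
      exact ⟨h1, h2, h.le⟩
    · rintro ⟨h1, h2, h⟩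
      exact ⟨lt_of_le_of_ne h (by rintro rfl; omega), h1, h2⟩
  rw [this]

variable {w : X → ℝ} {A : Set X} {π : ℤ → ℝ} {d : ℕ} {n : ℤ} {F : ℕ} {D : ℝ}

theorem IsHeavySet.dim_le (hH : IsHeavySet w A m π H) {x : X} (hx : x ∈ H) : dim x ≤ m := by
  rcases (hH x).1 hx with h | h
  · exact h.1.le
  · exact h.1.le

/-- The weight of the heavy faces of a given dimension is bounded by the weight of the
generating set. -/
theorem IsHeavySet.weight_le (hH : IsHeavySet w A m π H) (hW : WeightBounds X d w n F D)
    (hmn : (m : ℤ) + 1 ≤ n) (hπ : ∀ r, 0 < π r) (hπm : π m ≤ 1) (N : ℕ) :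
    π (m - N) * weightOf w {x | x ∈ H ∧ dim x = m - N} ≤ (1 + F : ℝ) ^ N * weightOf w A := by
  classical
  have hw0 : ∀ x, 0 ≤ w x := fun x => (hW.pos x).le
  have hA0 := weightOf_nonneg hw0 A
  induction N using Nat.strong_induction_on with
  | _ N ih =>
  rcases Nat.eq_zero_or_pos N with rfl | hN
  · have : {x | x ∈ H ∧ dim x = m - (0 : ℕ)} ⊆ A := by
      rintro x ⟨h, h'⟩
      rcases (hH x).1 h with h | h
      · exact h.2
      · have := h.1
        simp at h'
        omega
    have h1 := weightOf_mono hw0 this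
    have h2 := weightOf_nonneg hw0 {x | x ∈ H ∧ dim x = m - (0 : ℕ)}
    simp only [Nat.cast_zero, sub_zero, pow_zero, one_mul] at *
    have := (hπ m).le
    nlinarith
  -- The dimension witnessing heaviness depends on `x`, so the contributions of all larger
  -- dimensions are added up.
  · have key : ∀ x, x ∈ H → dim x = m - N → π (m - N) * w x ≤
        ∑ i ∈ Finset.range N, π (m - i) *
          weightOf w {y | y ∈ {y | y ∈ H ∧ dim y = m - i} ∧ x ≤ y} := by
      intro x hx hd
      rcases (hH x).1 hx with h | ⟨h, l, hl, hlm, hle⟩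
      · have := h.1
        omega
      · have hmem : (m - l).toNat ∈ Finset.range N := by
          rw [Finset.mem_range]
          omega
        refine le_trans ?_ (Finset.single_le_sum (f := fun i : ℕ => π (m - i) *
          weightOf w {y | y ∈ {y | y ∈ H ∧ dim y = m - i} ∧ x ≤ y})
          (fun i _ => mul_nonneg (hπ _).le (weightOf_nonneg hw0 _)) hmem)
        have h1 : (m : ℤ) - ((m - l).toNat : ℤ) = l := by omega
        simp only [h1]
        rw [hd] at hle
        have h2 : {y | y ∈ {y | y ∈ H ∧ dim y = l} ∧ x ≤ y} = {y | y ∈ H ∧ dim y = l ∧ x ≤ y} :=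
          Set.ext fun y => and_assoc
        rw [h2]
        exact hle
    calc π (m - N) * weightOf w {x | x ∈ H ∧ dim x = m - N}
        ≤ ∑ x with dim x = (m - N : ℤ), ∑ i ∈ Finset.range N, π (m - i) *
          weightOf w {y | y ∈ {y | y ∈ H ∧ dim y = m - i} ∧ x ≤ y} := by
          rw [weightOf_eq_sum_filter, Finset.mul_sum]
          refine (Finset.sum_le_sum fun x hx => key x ?_ ?_).trans ?_
          · simp at hx; exact hx.1
          · simp at hx; exact hx.2
          · refine Finset.sum_le_sum_of_subset_of_nonneg (fun x hx => ?_) fun x _ _ =>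
              Finset.sum_nonneg fun i _ => mul_nonneg (hπ _).le (weightOf_nonneg hw0 _)
            simp at hx ⊢
            exact hx.2
      _ = ∑ i ∈ Finset.range N, π (m - i) * ∑ x with dim x = (m - N : ℤ),
          weightOf w {y | y ∈ {y | y ∈ H ∧ dim y = m - i} ∧ x ≤ y} := by
          rw [Finset.sum_comm]
          simp only [Finset.mul_sum]
      _ ≤ ∑ i ∈ Finset.range N, F * ((1 + F : ℝ) ^ i * weightOf w A) := by
          refine Finset.sum_le_sum fun i hi => ?_
          have h1 := sum_weightOf_le hw0 (Finset.univ.filter fun x : X => dim x = (m - N : ℤ))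
            {y | y ∈ H ∧ dim y = m - i} (fun x y => x ≤ y) (N := F) fun y hy => by
              have h := hy.2
              have := hW.ncard_le y (by omega) (m - N)
              simp only [Finset.mem_filter, Finset.mem_univ, true_and]
              exact_mod_cast this
          calc _ ≤ π (m - i) * (F * weightOf w {y | y ∈ H ∧ dim y = m - i}) :=
                mul_le_mul_of_nonneg_left h1 (hπ _).le
            _ = F * (π (m - i) * weightOf w {y | y ∈ H ∧ dim y = m - i}) := by ring
            _ ≤ _ := mul_le_mul_of_nonneg_left (ih i (Finset.mem_range.1 hi)) (Nat.cast_nonneg _)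
      -- The geometric series is the source of the base `1 + F`: the recursion multiplies by `F`,
      -- the number of subfaces, and adds up all earlier levels.
      _ = (∑ i ∈ Finset.range N, (1 + F : ℝ) ^ i) * ((1 + F : ℝ) - 1) * weightOf w A := by
          rw [Finset.sum_mul, Finset.sum_mul]
          exact Finset.sum_congr rfl fun i _ => by ring
      _ = ((1 + F : ℝ) ^ N - 1) * weightOf w A := by rw [geom_sum_mul]
      _ ≤ _ := by nlinarith

theorem IsHeavySet.weight_le' (hH : IsHeavySet w A m π H) (hW : WeightBounds X d w n F D)
    (hmn : (m : ℤ) + 1 ≤ n) (hπ : ∀ r, 0 < π r) (hπm : π m ≤ 1) {r : ℤ}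
    (hr : -1 ≤ r) (hrm : r ≤ m) :
    π r * weightOf w {x | x ∈ H ∧ dim x = r} ≤ (1 + F : ℝ) ^ (m + 1) * weightOf w A := by
  have h := hH.weight_le hW hmn hπ hπm (m - r).toNat
  have h1 : (m : ℤ) - ((m - r).toNat : ℤ) = r := by omega
  rw [h1] at h
  refine h.trans (mul_le_mul_of_nonneg_right ?_ (weightOf_nonneg (fun x => (hW.pos x).le) A))
  refine pow_le_pow_right₀ ?_ (by omega)
  have : (0 : ℝ) ≤ F := Nat.cast_nonneg F
  linarith

/-- If the generating set is small, then the empty face is not heavy. -/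
theorem IsHeavySet.dim_nonneg (hH : IsHeavySet w A m π H) (hW : WeightBounds X d w n F D)
    (hmn : (m : ℤ) + 1 ≤ n) (hπ : ∀ r, 0 < π r) (hπm : π m ≤ 1)
    (hsmall : ∀ e : X, dim e = -1 → (1 + F : ℝ) ^ (m + 1) * weightOf w A < π (-1) * w e)
    {x : X} (hx : x ∈ H) : 0 ≤ dim x := by
  by_contra hneg
  have hd : dim x = -1 := by have := hW.neg_one_le x; omega
  -- A heavy empty face would force the heavy `l`-faces to outweigh the bound valid for all heavy
  -- `l`-faces.
  rcases (hH x).1 hx with h | ⟨h, l, hl, hlm, hle⟩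
  · have := h.1
    omega
  · have h1 := hsmall x hd
    have h2 := hH.weight_le' hW hmn hπ hπm (by omega) hlm
    have h3 : weightOf w {y | y ∈ H ∧ dim y = l ∧ x ≤ y} ≤ weightOf w {y | y ∈ H ∧ dim y = l} :=
      weightOf_mono (fun x => (hW.pos x).le) fun y hy => ⟨hy.1, hy.2.1⟩
    have h4 := mul_le_mul_of_nonneg_left h3 (hπ l).le
    rw [hd] at hle
    linarith

theorem exists_terminal (P : AbstractIntersectionProfile m) (H : Set X) (x : X) :
    ∃ y, Relation.ReflTransGen (Desc P H) x y ∧ ∀ z, ¬ Desc P H y z := by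
  induction x using (wellFounded_lt (α := X)).induction with
  | _ x ih =>
  by_cases h : ∃ z, Desc P H x z
  · obtain ⟨z, hz⟩ := h
    obtain ⟨y, hy, hy'⟩ := ih z hz.2.1
    exact ⟨y, hy.head hz, hy'⟩
  · push Not at h
    exact ⟨x, .refl, h⟩

/-- Below a face without bad subfaces, all descending chains of heavy faces have the same end. -/
theorem desc_terminal {P : AbstractIntersectionProfile m} (hP : P.IsProfileFor X)
    (hbot : ∃ e : X, dim e = -1 ∧ ∀ x : X, e ≤ x) {z x y : X} (hz : ∀ a, a ≤ z → ¬ IsBad P H a)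
    (hx : Relation.ReflTransGen (Desc P H) z x) (hy : Relation.ReflTransGen (Desc P H) z y)
    (hterm : ∀ t, ¬ Desc P H y t) : Relation.ReflTransGen (Desc P H) x y := by
  obtain ⟨e, hde, he⟩ := hbot
  -- Descent is restricted to faces below `z`, since only these are known not to be bad.
  let r : X → X → Prop := fun a b => Desc P H a b ∧ a ≤ z
  have hlift : ∀ b, Relation.ReflTransGen (Desc P H) z b → Relation.ReflTransGen r z b := by
    intro b hb
    induction hb with
    | refl => exact .refl
    | tail h1 h2 ih => exact ih.tail ⟨h2, le_of_desc h1⟩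
  -- The diamond property. For comparable `b` and `c`, the third profile axiom makes the step from
  -- `b` to `c` admissible. Otherwise an infimum of `b` and `c` closes the diamond: it is heavy
  -- since `a` is not bad, and it is admissible below both by the first axiom.
  have hdia : ∀ a b c, r a b → r a c → dim c ≤ dim b →
      ∃ t, Relation.ReflGen r b t ∧ Relation.ReflGen r c t := by
    rintro a b c ⟨hb, haz⟩ ⟨hc, -⟩ hdim
    have hbz : b ≤ z := hb.2.1.le.trans haz
    have hcz : c ≤ z := hc.2.1.le.trans haz
    by_cases hcb : c ≤ b
    · rcases hcb.eq_or_lt with rfl | hlt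
      · exact ⟨c, .refl, .refl⟩
      · refine ⟨c, .single ⟨⟨hc.1, hlt, ?_⟩, hbz⟩, .refl⟩
        exact P.ad_of_ad _ _ _ (dim_strictMono hb.2.1) (dim_strictMono hlt)
          (P.ad_range _ _ hc.2.2).2.2 hb.2.2 hc.2.2
    · obtain ⟨v, hv, -⟩ := exists_infima (A := {b, c}) (e := e) (by
        rintro t (rfl | rfl) <;> exact he _)
      have hvH : v ∈ H := by
        by_contra hvH
        exact hz a haz ⟨b, c, hb.1, hc.1, hb.2, hc.2, hdim, hcb, v, hv, hvH⟩
      have hq := (hP a b c hb.2 hc.2 hdim).resolve_left hcb v hv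
      obtain ⟨-, -, h1, h2⟩ := P.ad_of_quads _ _ _ _ hq
      have hvb : v ≤ b := hv.1 (by simp)
      have hvc : v ≤ c := hv.1 (by simp)
      have d1 := (P.ad_range _ _ h1).2.1
      have d2 := (P.ad_range _ _ h2).2.1
      exact ⟨v, .single ⟨⟨hvH, lt_of_le_of_ne hvb (by rintro rfl; omega), h1⟩, hbz⟩,
        .single ⟨⟨hvH, lt_of_le_of_ne hvc (by rintro rfl; omega), h2⟩, hcz⟩⟩
  have hrefl : ∀ {a b : X}, Relation.ReflGen r a b → Relation.ReflTransGen r a b := by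
    intro a b h
    cases h with
    | refl => exact .refl
    | single h => exact .single h
  -- Confluence gives a common descendant of `x` and `y`, which must be `y` itself because `y` is
  -- terminal.
  obtain ⟨t, hxt, hyt⟩ := Relation.church_rosser (r := r) (fun a b c hb hc => by
    rcases le_total (dim c) (dim b) with h | h
    · obtain ⟨t, h1, h2⟩ := hdia a b c hb hc h
      exact ⟨t, h1, hrefl h2⟩
    · obtain ⟨t, h1, h2⟩ := hdia a c b hc hb h
      exact ⟨t, h2, hrefl h1⟩) (hlift x hx) (hlift y hy)
  have hyt' : y = t := by
    rcases hyt.cases_head with h | ⟨c, h, -⟩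
    · exact h
    · exact (hterm c h.1).elim
  rw [hyt']
  exact Relation.ReflTransGen.mono (r := r) (fun _ _ h => h.1) _ _ hxt

/-- The skeleton expansion hypothesis on `X` and its links, in terms of the weights of `X`. -/
def SkeletonBound (w : X → ℝ) (P : AbstractIntersectionProfile m) (π : ℤ → ℝ) (B c E : ℝ) : Prop :=
  ∀ t l r b : ℤ, (t, l, r, b) ∈ P.quads → ∀ v : X, dim v = b → ∀ A : Set X,
    (∀ x ∈ A, v ≤ x ∧ (dim x = l ∨ dim x = r)) →
    weightOf w {z | dim z = t ∧ ∃ x ∈ A, ∃ y ∈ A, x ≠ y ∧ x ≤ z ∧ y ≤ z ∧ v ∈ infima {x, y} ∧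
      dim x = l ∧ dim y = r} ≤
    E * (c * π r * weightOf w A + B * c * π r ^ 2 / π b * weightOf w A ^ 2 / w v)

variable {P : AbstractIntersectionProfile m} {B c E : ℝ}

/-- If `v` is not heavy, the heavy `l`- and `r`-faces above it have weight `a` with `π r * a ≤ 2 * π
b * w v`. This turns the quadratic term of the skeleton bound into `2 * B` times the linear one. The
linear bounds are then summed over `v`. -/
theorem weightOf_bad_quad_le (hH : IsHeavySet w A m π H) (hW : WeightBounds X d w n F D)
    (hmn : (m : ℤ) + 1 ≤ n) (hπ : ∀ r, 0 < π r) (hπm : π m ≤ 1)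
    (hπmono : ∀ r l : ℤ, -1 ≤ r → r ≤ l → l ≤ m → π r ≤ π l) (hB : 0 ≤ B) (hc : 0 ≤ c)
    (hE : 0 ≤ E) (hSk : SkeletonBound w P π B c E) {t l r b : ℤ} (hq : (t, l, r, b) ∈ P.quads) :
    weightOf w {z | dim z = t ∧ ∃ y y' v : X, y ∈ H ∧ y' ∈ H ∧ y ≤ z ∧ y' ≤ z ∧ y ≠ y' ∧
      dim y = l ∧ dim y' = r ∧ dim v = b ∧ v ∈ infima {y, y'} ∧ v ∉ H} ≤
    E * (1 + 2 * B) * F * (2 * (1 + F : ℝ) ^ (m + 1)) * c * weightOf w A := by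
  classical
  have hw0 : ∀ x, 0 ≤ w x := fun x => (hW.pos x).le
  obtain ⟨q1, q2, q3, q4, q5⟩ := P.quads_range _ _ _ _ hq
  let S : Set X := {x | x ∈ H ∧ (dim x = l ∨ dim x = r)}
  let s : Finset X := Finset.univ.filter fun v : X => dim v = b ∧ v ∉ H
  have hS : π r * weightOf w S ≤ 2 * (1 + F : ℝ) ^ (m + 1) * weightOf w A := by
    have h1 : weightOf w S ≤ weightOf w {x | x ∈ H ∧ dim x = l} + weightOf w {x | x ∈ H ∧ dim x = r} :=
      (weightOf_mono hw0 fun x hx => by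
        rcases hx.2 with h | h
        · exact Or.inl ⟨hx.1, h⟩
        · exact Or.inr ⟨hx.1, h⟩).trans (weightOf_union_le hw0 _ _)
    have h2 := hH.weight_le' hW hmn hπ hπm (r := l) (by omega) (by omega)
    have h3 := hH.weight_le' hW hmn hπ hπm (r := r) (by omega) (by omega)
    have h4 := mul_le_mul_of_nonneg_right (hπmono r l (by omega) (by omega) (by omega))
      (weightOf_nonneg hw0 {x | x ∈ H ∧ dim x = l})
    have h5 := mul_le_mul_of_nonneg_left h1 (hπ r).le
    linarith
  have hv : ∀ v ∈ s, weightOf w {z | dim z = t ∧ ∃ x ∈ {x | x ∈ S ∧ v ≤ x},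
      ∃ y ∈ {x | x ∈ S ∧ v ≤ x}, x ≠ y ∧ x ≤ z ∧ y ≤ z ∧ v ∈ infima {x, y} ∧
      dim x = l ∧ dim y = r} ≤ E * (1 + 2 * B) * c * (π r * weightOf w {x | x ∈ S ∧ v ≤ x}) := by
    intro v hv
    simp only [s, Finset.mem_filter, Finset.mem_univ, true_and] at hv
    refine (hSk t l r b hq v hv.1 {x | x ∈ S ∧ v ≤ x} fun x hx => ⟨hx.2, hx.1.2⟩).trans ?_
    -- Not being heavy means failing the defining inequality in every larger dimension at once.
    have hlight : ∀ j : ℤ, b < j → j ≤ m →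
        π j * weightOf w {y | y ∈ H ∧ dim y = j ∧ v ≤ y} ≤ π b * w v := by
      intro j hj hjm
      by_contra h
      push Not at h
      exact hv.2 ((hH v).2 (Or.inr ⟨by omega, j, by omega, hjm, by rw [hv.1]; exact h.le⟩))
    have h1 : weightOf w {x | x ∈ S ∧ v ≤ x} ≤ weightOf w {y | y ∈ H ∧ dim y = l ∧ v ≤ y} +
        weightOf w {y | y ∈ H ∧ dim y = r ∧ v ≤ y} :=
      (weightOf_mono hw0 fun x hx => by
        rcases hx.1.2 with h | h
        · exact Or.inl ⟨hx.1.1, h, hx.2⟩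
        · exact Or.inr ⟨hx.1.1, h, hx.2⟩).trans (weightOf_union_le hw0 _ _)
    have h2 := hlight l (by omega) (by omega)
    have h3 := hlight r (by omega) (by omega)
    have h4 := mul_le_mul_of_nonneg_right (hπmono r l (by omega) (by omega) (by omega))
      (weightOf_nonneg hw0 {y | y ∈ H ∧ dim y = l ∧ v ≤ y})
    have h5 := mul_le_mul_of_nonneg_left h1 (hπ r).le
    have h0 := weightOf_nonneg hw0 {x | x ∈ S ∧ v ≤ x}
    have hwv := hW.pos v
    have hpb := hπ b
    have hpr := hπ r
    generalize weightOf w {x | x ∈ S ∧ v ≤ x} = a at *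
    have h6 : π r * a ≤ 2 * (π b * w v) := by linarith
    -- One of the two factors `π r * a` is traded for `2 * (π b * w v)`, which cancels the
    -- denominators.
    have h7 : B * c * π r ^ 2 / π b * a ^ 2 / w v ≤ 2 * B * c * (π r * a) := by
      rw [div_mul_eq_mul_div, div_div, div_le_iff₀ (by positivity)]
      calc B * c * π r ^ 2 * a ^ 2 = B * c * (π r * a) * (π r * a) := by ring
        _ ≤ B * c * (π r * a) * (2 * (π b * w v)) := by gcongr
        _ = _ := by ring
    calc E * (c * π r * a + B * c * π r ^ 2 / π b * a ^ 2 / w v)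
        ≤ E * (c * π r * a + 2 * B * c * (π r * a)) := by gcongr
      _ = _ := by ring
  have hcov := weightOf_biUnion_le hw0 s
    (A := {z | dim z = t ∧ ∃ y y' v : X, y ∈ H ∧ y' ∈ H ∧ y ≤ z ∧ y' ≤ z ∧ y ≠ y' ∧
      dim y = l ∧ dim y' = r ∧ dim v = b ∧ v ∈ infima {y, y'} ∧ v ∉ H})
    (fun v => {z | dim z = t ∧ ∃ x ∈ {x | x ∈ S ∧ v ≤ x},
      ∃ y ∈ {x | x ∈ S ∧ v ≤ x}, x ≠ y ∧ x ≤ z ∧ y ≤ z ∧ v ∈ infima {x, y} ∧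
      dim x = l ∧ dim y = r}) (by
        rintro z ⟨hzt, y, y', v, hy, hy', hyz, hyz', hne, hdy, hdy', hdv, hv, hvH⟩
        refine ⟨v, by simp [s, hdv, hvH], hzt, y, ⟨⟨hy, Or.inl hdy⟩, hv.1 (by simp)⟩,
          y', ⟨⟨hy', Or.inr hdy'⟩, hv.1 (by simp)⟩, hne, hyz, hyz', hv, hdy, hdy'⟩)
  -- A heavy face is counted once for each of its `b`-dimensional subfaces `v`, hence at most `F`
  -- times.
  have hsum := sum_weightOf_le hw0 s S (fun v x => v ≤ x) (N := F) fun x hx => by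
    have hd : dim x ≤ n := by
      have := hH.dim_le hx.1
      omega
    have h1 : {v | v ∈ s ∧ v ≤ x} ⊆ {v | dim v = b ∧ v ≤ x} := by
      rintro v ⟨h, h'⟩
      simp only [s, Finset.mem_filter, Finset.mem_univ, true_and] at h
      exact ⟨h.1, h'⟩
    exact_mod_cast (Set.ncard_le_ncard h1 (Set.toFinite _)).trans (hW.ncard_le x hd b)
  have hF0 : (0 : ℝ) ≤ F := Nat.cast_nonneg F
  calc _ ≤ _ := hcov
    _ ≤ ∑ v ∈ s, E * (1 + 2 * B) * c * (π r * weightOf w {x | x ∈ S ∧ v ≤ x}) :=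
      Finset.sum_le_sum hv
    _ = E * (1 + 2 * B) * c * π r * ∑ v ∈ s, weightOf w {x | x ∈ S ∧ v ≤ x} := by
      rw [Finset.mul_sum]
      exact Finset.sum_congr rfl fun v _ => by ring
    _ ≤ E * (1 + 2 * B) * c * π r * (F * weightOf w S) := by
      have := (hπ r).le
      gcongr
    _ = E * (1 + 2 * B) * c * F * (π r * weightOf w S) := by ring
    _ ≤ E * (1 + 2 * B) * c * F * (2 * (1 + F : ℝ) ^ (m + 1) * weightOf w A) := by gcongr
    _ = _ := by ring

/-- The profile property places the dimensions of every offending configuration in `P.quads`, and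
for fixed `t` at most `(m + 2) ^ 3` triples remain. -/
theorem weightOf_bad_le (hP : P.IsProfileFor X) (hH : IsHeavySet w A m π H)
    (hW : WeightBounds X d w n F D)
    (hmn : (m : ℤ) + 1 ≤ n) (hπ : ∀ r, 0 < π r) (hπm : π m ≤ 1)
    (hπmono : ∀ r l : ℤ, -1 ≤ r → r ≤ l → l ≤ m → π r ≤ π l) (hB : 0 ≤ B) (hc : 0 ≤ c)
    (hE : 0 ≤ E) (hSk : SkeletonBound w P π B c E) (t : ℤ) :
    weightOf w {z | dim z = t ∧ IsBad P H z} ≤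
    (m + 2 : ℕ) ^ 3 * (E * (1 + 2 * B) * F * (2 * (1 + F : ℝ) ^ (m + 1)) * c * weightOf w A) := by
  classical
  have hw0 : ∀ x, 0 ≤ w x := fun x => (hW.pos x).le
  let I : Finset ℤ := Finset.Icc (-1) m
  let s : Finset (ℤ × ℤ × ℤ) := (I ×ˢ I ×ˢ I).filter fun q => (t, q.1, q.2.1, q.2.2) ∈ P.quads
  refine (weightOf_biUnion_le hw0 s (fun q => {z | dim z = t ∧ ∃ y y' v : X, y ∈ H ∧ y' ∈ H ∧
    y ≤ z ∧ y' ≤ z ∧ y ≠ y' ∧ dim y = q.1 ∧ dim y' = q.2.1 ∧ dim v = q.2.2 ∧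
    v ∈ infima {y, y'} ∧ v ∉ H}) ?_).trans ?_
  · rintro z ⟨hzt, y, y', hy, hy', ha, ha', hdim, hle, v, hv, hvH⟩
    have hq := (hP z y y' ha ha' hdim).resolve_left hle v hv
    rw [hzt] at hq
    refine ⟨(dim y, dim y', dim v), ?_, hzt, y, y', v, hy, hy', ha.1.le, ha'.1.le, ?_, rfl, rfl,
      rfl, hv, hvH⟩
    · obtain ⟨q1, q2, q3, q4, q5⟩ := P.quads_range _ _ _ _ hq
      simp only [s, I, Finset.mem_filter, Finset.mem_product, Finset.mem_Icc]
      exact ⟨⟨⟨by omega, by omega⟩, ⟨by omega, by omega⟩, ⟨by omega, by omega⟩⟩, hq⟩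
    · rintro rfl
      exact hle le_rfl
  · have hcard : (s.card : ℝ) ≤ ((m + 2 : ℕ) : ℝ) ^ 3 := by
      have h1 : s.card ≤ (I ×ˢ I ×ˢ I).card := Finset.card_filter_le _ _
      have h2 : (I ×ˢ I ×ˢ I).card = (m + 2) ^ 3 := by
        rw [Finset.card_product, Finset.card_product, Int.card_Icc]
        have : ((m : ℤ) + 1 - -1).toNat = m + 2 := by omega
        rw [this]
        ring
      exact_mod_cast h2 ▸ h1
    have hnn : 0 ≤ E * (1 + 2 * B) * F * (2 * (1 + F : ℝ) ^ (m + 1)) * c * weightOf w A := by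
      have := weightOf_nonneg hw0 A
      positivity
    refine (Finset.sum_le_card_nsmul _ _
      (E * (1 + 2 * B) * F * (2 * (1 + F : ℝ) ^ (m + 1)) * c * weightOf w A) fun q hq => ?_).trans ?_
    · simp only [s, Finset.mem_filter] at hq
      exact weightOf_bad_quad_le hH hW hmn hπ hπm hπmono hB hc hE hSk hq.2
    · rw [nsmul_eq_mul]
      exact mul_le_mul_of_nonneg_right hcard hnn

/-- The total weight of the `(m + 1)`-faces having a bad subface. -/
theorem weightOf_above_bad_le (hP : P.IsProfileFor X) (hH : IsHeavySet w A m π H)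
    (hW : WeightBounds X d w n F D)
    (hmn : (m : ℤ) + 1 ≤ n) (hπ : ∀ r, 0 < π r) (hπm : π m ≤ 1)
    (hπmono : ∀ r l : ℤ, -1 ≤ r → r ≤ l → l ≤ m → π r ≤ π l) (hB : 0 ≤ B) (hc : 0 ≤ c)
    (hE : 0 ≤ E) (hSk : SkeletonBound w P π B c E) :
    weightOf w {z | dim z = m + 1 ∧ ∃ a ≤ z, IsBad P H a} ≤
    (m + 3 : ℕ) * (D * ((m + 2 : ℕ) ^ 3 *
      (E * (1 + 2 * B) * F * (2 * (1 + F : ℝ) ^ (m + 1)) * c * weightOf w A))) := by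
  classical
  have hw0 : ∀ x, 0 ≤ w x := fun x => (hW.pos x).le
  have hD : 0 ≤ D := zero_le_one.trans hW.one_le
  refine (weightOf_biUnion_le hw0 (Finset.Icc (-1 : ℤ) (m + 1)) (fun t => {z | dim z = m + 1 ∧
    ∃ a, a ≤ z ∧ dim a = t ∧ IsBad P H a}) ?_).trans ?_
  · rintro z ⟨hz, a, haz, ha⟩
    exact ⟨dim a, Finset.mem_Icc.2 ⟨hW.neg_one_le a, hz ▸ dim_mono haz⟩, hz, a, haz, rfl, ha⟩
  · refine (Finset.sum_le_card_nsmul _ _ (D * ((m + 2 : ℕ) ^ 3 *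
        (E * (1 + 2 * B) * F * (2 * (1 + F : ℝ) ^ (m + 1)) * c * weightOf w A))) fun t _ => ?_).trans
        ?_
    -- The weight of bad faces of one dimension is pushed up to the `(m + 1)`-faces above them at
    -- the cost of a factor `D`.
    · calc _ ≤ ∑ a with dim a = t ∧ IsBad P H a, weightOf w {z | dim z = m + 1 ∧ a ≤ z} :=
            weightOf_biUnion_le hw0 _ _ (by
              rintro z ⟨hz, a, haz, hat, ha⟩
              exact ⟨a, by simp [hat, ha], hz, haz⟩)
        _ ≤ ∑ a with dim a = t ∧ IsBad P H a, D * w a :=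
            Finset.sum_le_sum fun a _ => hW.above_le a _ hmn
        _ = D * weightOf w {z | dim z = t ∧ IsBad P H z} := by
            rw [weightOf_eq_sum_filter, Finset.mul_sum]
            simp only [Set.mem_ofPred_eq]
        _ ≤ _ := mul_le_mul_of_nonneg_left
            (weightOf_bad_le hP hH hW hmn hπ hπm hπmono hB hc hE hSk t) hD
    · rw [nsmul_eq_mul, Int.card_Icc]
      have : ((m : ℤ) + 1 + 1 - -1).toNat = m + 3 := by omega
      rw [this]

end Heavy

/-! ### Weights of sets of link faces. -/

section LinkSets

variable {X : Type u} [PartialOrder X] [GradeOrder ℤ X] [Fintype X] {d : ℕ} {w : X → ℝ} {n : ℤ}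
  {F : ℕ} {D : ℝ}

theorem WeightBounds.weightOf_link_le (hW : WeightBounds X d w n F D) (u : X) {A : Set (Link u)}
    (hA : ∀ x ∈ A, dim x.1 ≤ n) :
    w u * weightOf (linkWeight d w u) A ≤ D * weightOf w (Subtype.val '' A) := by
  rw [weightOf_image Subtype.val_injective, ← weightOf_const_mul]
  exact weightOf_le_mul fun x hx => hW.link_le u x (hA x hx)

theorem WeightBounds.le_weightOf_link (hW : WeightBounds X d w n F D) (u : X) {A : Set (Link u)}
    (hA : ∀ x ∈ A, dim x.1 ≤ n) :
    weightOf w (Subtype.val '' A) ≤ D * (w u * weightOf (linkWeight d w u) A) := by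
  rw [weightOf_image Subtype.val_injective, ← mul_assoc]
  exact weightOf_le_mul fun x hx => (hW.le_link u x (hA x hx)).trans_eq (mul_assoc _ _ _).symm

end LinkSets

/-! ### Cochains, supports, and extension from links. -/

section Sheaf

variable {R : Type v} [CommRing R] {X : Type u} [PartialOrder X] [GradeOrder ℤ X]
  {S : PosetSheaf.{u, v, w} R X} {i j : ℤ}

theorem mem_supp {f : Cochain S i} {x : X} : x ∈ supp f ↔ ∃ h : dim x = i, f ⟨x, h⟩ ≠ 0 := Iff.rfl

theorem supp_add_subset (f g : Cochain S i) : supp (f + g) ⊆ supp f ∪ supp g := by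
  rintro x ⟨h, hx⟩
  by_contra hn
  simp only [Set.mem_union, mem_supp, not_or, not_exists, not_not] at hn
  exact hx (by rw [Pi.add_apply, hn.1 h, hn.2 h, add_zero])

theorem supp_neg (f : Cochain S i) : supp (-f) = supp f := by
  ext x
  simp only [mem_supp, Pi.neg_apply, ne_eq, neg_eq_zero]

theorem supp_zero : supp (0 : Cochain S i) = ∅ := by
  ext x
  simp [mem_supp]

/-- The restriction of a cochain to a link. -/
def restrictLink (u : X) (f : Cochain S i) : Cochain (S.link u) (i - dim u - 1) := fun x =>
  f ⟨x.1.1, by have := x.2; rw [dim_link] at this; omega⟩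

theorem extendLink_apply (u : X) (g : Cochain (S.link u) (i - dim u - 1)) {x : X} (hx : dim x = i)
    (h : u ≤ x) : extendLink S u i g ⟨x, hx⟩ =
      g ⟨(⟨x, h⟩ : Link u), by rw [dim_link, hx]⟩ := dif_pos h

theorem extendLink_apply_of_not_le (u : X) (g : Cochain (S.link u) (i - dim u - 1)) {x : X}
    (hx : dim x = i) (h : ¬ u ≤ x) : extendLink S u i g ⟨x, hx⟩ = 0 := dif_neg h

theorem extendLink_restrictLink (u : X) (f : Cochain S i) (hf : ∀ x ∈ supp f, u ≤ x) :
    extendLink S u i (restrictLink u f) = f := by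
  funext ⟨x, hx⟩
  by_cases h : u ≤ x
  · exact extendLink_apply u _ hx h
  · rw [extendLink_apply_of_not_le u _ hx h]
    by_contra hne
    exact h (hf x ⟨hx, Ne.symm hne⟩)

theorem extendLink_sub (u : X) (g g' : Cochain (S.link u) (i - dim u - 1)) :
    extendLink S u i (g - g') = extendLink S u i g - extendLink S u i g' := by
  funext ⟨x, hx⟩
  rw [Pi.sub_apply]
  by_cases h : u ≤ x
  · rw [extendLink_apply u _ hx h, extendLink_apply u _ hx h, extendLink_apply u _ hx h]
    rfl
  · simp only [extendLink_apply_of_not_le u _ hx h, sub_zero]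

theorem extendLink_neg (u : X) (g : Cochain (S.link u) (i - dim u - 1)) :
    extendLink S u i (-g) = -extendLink S u i g := by
  funext ⟨x, hx⟩
  rw [Pi.neg_apply]
  by_cases h : u ≤ x
  · rw [extendLink_apply u _ hx h, extendLink_apply u _ hx h]
    rfl
  · simp only [extendLink_apply_of_not_le u _ hx h, neg_zero]

theorem image_supp_link (u : X) (g : Cochain (S.link u) (i - dim u - 1)) :
    Subtype.val '' supp g = supp (extendLink S u i g) := by
  ext x
  constructor
  · rintro ⟨x, ⟨hd, hx⟩, rfl⟩
    have hd' : dim x.1 = i := by rw [dim_link] at hd; omega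
    exact ⟨hd', by rw [extendLink_apply u g hd' x.2]; exact hx⟩
  · rintro ⟨hd, hx⟩
    by_cases h : u ≤ x
    · rw [extendLink_apply u g hd h] at hx
      exact ⟨⟨x, h⟩, ⟨by rw [dim_link, hd], hx⟩, rfl⟩
    · exact (hx (extendLink_apply_of_not_le u g hd h)).elim

theorem dim_of_mem_supp_link (u : X) {g : Cochain (S.link u) i} {x : Link u} (hx : x ∈ supp g) :
    dim x.1 = i + dim u + 1 := by
  have := hx.1
  rw [dim_link] at this
  omega

section Coboundary

variable [Fintype X]

open Classical in
theorem coboundary_apply (o : PosetOrientation R X) (hij : i + 1 = j) (f : Cochain S i)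
    (y : {y : X // dim y = j}) :
    coboundary o S i j hij f y = ∑ x : {x : X // dim x = i},
      if h : x.1 ≤ y.1 then (o.coeff y.1 x.1 : R) • S.res h (f x) else 0 := by
  simp only [coboundary, LinearMap.pi_apply, LinearMap.sum_apply]
  refine Finset.sum_congr rfl fun x _ => ?_
  split_ifs <;> rfl

theorem coboundary_congr (o : PosetOrientation R X) (hij : i + 1 = j) {f g : Cochain S i} {y : X}
    (hy : dim y = j) (h : ∀ (x : X) (hx : dim x = i), x ≤ y → f ⟨x, hx⟩ = g ⟨x, hx⟩) :
    coboundary o S i j hij f ⟨y, hy⟩ = coboundary o S i j hij g ⟨y, hy⟩ := by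
  classical
  rw [coboundary_apply, coboundary_apply]
  refine Finset.sum_congr rfl fun x _ => ?_
  split_ifs with hxy
  · rw [h x.1 x.2 hxy]
  · rfl

theorem exists_of_mem_supp_coboundary (o : PosetOrientation R X) (hij : i + 1 = j)
    {f : Cochain S i} {y : X} (hy : y ∈ supp (coboundary o S i j hij f)) :
    ∃ x ∈ supp f, x ≤ y := by
  obtain ⟨hd, hne⟩ := hy
  by_contra h
  push Not at h
  refine hne ?_
  rw [coboundary_congr o hij (g := 0) hd, map_zero, Pi.zero_apply]
  intro x hx hxy
  by_contra hx0
  exact h x ⟨hx, hx0⟩ hxy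

/-- The coboundary commutes with extension by zero from a link. -/
theorem coboundary_extendLink (o : PosetOrientation R X) (hij : i + 1 = j) (u : X)
    (g : Cochain (S.link u) (i - dim u - 1)) {j' : ℤ} (hj' : i - dim u - 1 + 1 = j') {y : X}
    (hy : dim y = j) (huy : u ≤ y) (hy' : dim (⟨y, huy⟩ : Link u) = j') :
    coboundary o S i j hij (extendLink S u i g) ⟨y, hy⟩ =
      coboundary (o.link u) (S.link u) (i - dim u - 1) j' hj' g ⟨⟨y, huy⟩, hy'⟩ := by
  classical
  rw [coboundary_apply, coboundary_apply]
  symm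
  refine Fintype.sum_of_injective
    (fun x : {x : Link u // dim x = i - dim u - 1} => (⟨x.1.1, by
      have := x.2; rw [dim_link] at this; omega⟩ : {x : X // dim x = i})) ?_ _ _ ?_ ?_
  · intro a b hab
    exact Subtype.ext (Subtype.ext (congrArg (fun x => x.1) hab))
  · rintro ⟨x, hx⟩ hnot
    have hux : ¬ u ≤ x := fun hux => hnot ⟨⟨⟨x, hux⟩, by rw [dim_link, hx]⟩, rfl⟩
    rw [extendLink_apply_of_not_le u g hx hux]
    split_ifs
    · rw [map_zero]
      exact smul_zero _
    · rfl
  · rintro ⟨x, hx⟩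
    have hd : dim x.1 = i := by rw [dim_link] at hx; omega
    have hcond : x ≤ (⟨y, huy⟩ : Link u) ↔ x.1 ≤ y := Iff.rfl
    by_cases hxy : x.1 ≤ y
    · rw [dif_pos hxy, dif_pos (hcond.2 hxy), extendLink_apply u g hd x.2]
      rfl
    · rw [dif_neg hxy, dif_neg (fun h => hxy (hcond.1 h))]
      rfl

/-- Both sides vanish away from the link, since a face in the support of the coboundary has a
subface containing `u`. The equation between degrees is an argument because the two expressions for
the target degree do not agree definitionally. -/
theorem extendLink_coboundary (o : PosetOrientation R X) (hij : i + 1 = j) (u : X)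
    (g : Cochain (S.link u) (i - dim u - 1)) (hj' : i - dim u - 1 + 1 = j - dim u - 1) :
    extendLink S u j (coboundary (o.link u) (S.link u) (i - dim u - 1) (j - dim u - 1) hj' g) =
      coboundary o S i j hij (extendLink S u i g) := by
  funext ⟨y, hy⟩
  by_cases huy : u ≤ y
  · rw [extendLink_apply u _ hy huy, coboundary_extendLink o hij u g hj' hy huy]
  · rw [extendLink_apply_of_not_le u _ hy huy]
    by_contra hne
    obtain ⟨x, hx, hxy⟩ := exists_of_mem_supp_coboundary o hij (f := extendLink S u i g)
      ⟨hy, Ne.symm hne⟩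
    rw [← image_supp_link] at hx
    obtain ⟨x, -, rfl⟩ := hx
    exact huy (x.2.trans hxy)

/-- In the value at `z`, the coefficient of the restriction of `f x` is the sum of `[z : y][y : x]`
over the intermediate `y`, which the orientation axiom kills. -/
theorem coboundary_coboundary (o : PosetOrientation R X) {l : ℤ} (hij : i + 1 = j) (hjl : j + 1 = l)
    (f : Cochain S i) : coboundary o S j l hjl (coboundary o S i j hij f) = 0 := by
  classical
  funext ⟨z, hz⟩
  rw [coboundary_apply, Pi.zero_apply]
  have h1 : ∀ y : {y : X // dim y = j},
      (if h : y.1 ≤ z then (o.coeff z y.1 : R) • S.res h (coboundary o S i j hij f y) else 0) =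
      ∑ x : {x : X // dim x = i}, if hxz : x.1 ≤ z then
        (if x.1 ≤ y.1 ∧ y.1 ≤ z then (o.coeff z y.1 : R) * (o.coeff y.1 x.1 : R) else 0) •
          S.res hxz (f x) else 0 := by
    intro y
    by_cases hyz : y.1 ≤ z
    · rw [dif_pos hyz, coboundary_apply, map_sum, Finset.smul_sum]
      refine Finset.sum_congr rfl fun x _ => ?_
      by_cases hxy : x.1 ≤ y.1
      · rw [dif_pos hxy, dif_pos (hxy.trans hyz), if_pos ⟨hxy, hyz⟩, map_smul, smul_smul,
          ← S.res_comp hxy hyz, LinearMap.comp_apply]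
      · rw [dif_neg hxy, map_zero, smul_zero]
        simp [hxy]
    · rw [dif_neg hyz]
      symm
      refine Finset.sum_eq_zero fun x _ => ?_
      simp [hyz]
  rw [Finset.sum_congr rfl fun y _ => h1 y, Finset.sum_comm]
  refine Finset.sum_eq_zero fun x _ => ?_
  by_cases hxz : x.1 ≤ z
  · simp only [dif_pos hxz]
    rw [← Finset.sum_smul]
    have hx := x.2
    have key := o.sum_eq_zero x.1 z hxz (by omega)
    have h2 : ∑ y : {y : X // dim y = j},
        (if x.1 ≤ y.1 ∧ y.1 ≤ z then (o.coeff z y.1 : R) * (o.coeff y.1 x.1 : R) else 0) =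
        ∑ᶠ y ∈ {y : X | x.1 < y ∧ y < z}, (o.coeff z y : R) * (o.coeff y x.1 : R) := by
      rw [finsum_mem_eq_finite_toFinset_sum _ (Set.toFinite _), ← Finset.sum_filter]
      refine Finset.sum_nbij (fun y => y.1) ?_ ?_ ?_ ?_
      · intro y hy
        have hy' := y.2
        simp only [Finset.mem_filter, Finset.mem_univ, true_and] at hy
        simp only [Set.Finite.mem_toFinset, Set.mem_ofPred_eq]
        exact ⟨lt_of_le_of_ne hy.1 (fun h => by rw [h] at hx; omega),
          lt_of_le_of_ne hy.2 (fun h => by rw [h] at hy'; omega)⟩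
      · exact Subtype.val_injective.injOn
      · intro y hy
        simp only [Set.Finite.coe_toFinset, Set.mem_ofPred_eq] at hy
        have d1 := dim_strictMono hy.1
        have d2 := dim_strictMono hy.2
        exact ⟨⟨y, by omega⟩, by simp [hy.1.le, hy.2.le], rfl⟩
      · intro y _
        rfl
    rw [h2, key, zero_smul]
  · simp only [dif_neg hxz]
    exact Finset.sum_const_zero

end Coboundary

/-! ### Norms, distances and expansion of links. -/

section Norm

variable [Fintype X] {w : X → ℝ}

theorem wnorm_nonneg (hw : ∀ x, 0 ≤ w x) (f : Cochain S i) : 0 ≤ wnorm w f := weightOf_nonneg hw _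

theorem wnorm_add_le (hw : ∀ x, 0 ≤ w x) (f g : Cochain S i) :
    wnorm w (f + g) ≤ wnorm w f + wnorm w g :=
  (weightOf_mono hw (supp_add_subset f g)).trans (weightOf_union_le hw _ _)

theorem wnorm_neg (f : Cochain S i) : wnorm w (-f) = wnorm w f := by
  rw [wnorm, wnorm, supp_neg]

theorem wnorm_zero : wnorm w (0 : Cochain S i) = 0 := by
  simp [wnorm, weightOf, supp_zero]

theorem eq_zero_of_wnorm_le_zero (hw : ∀ x, 0 < w x) {f : Cochain S i} (h : wnorm w f ≤ 0) :
    f = 0 := by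
  funext ⟨x, hx⟩
  by_contra hne
  have := le_weightOf (fun x => (hw x).le) (show x ∈ supp f from ⟨hx, hne⟩)
  have := hw x
  rw [wnorm] at h
  linarith

theorem wdistTo_nonneg (hw : ∀ x, 0 ≤ w x) (f : Cochain S i) (A : Set (Cochain S i)) :
    0 ≤ wdistTo w f A := Real.iInf_nonneg fun _ => wnorm_nonneg hw _

theorem wdistTo_le (hw : ∀ x, 0 ≤ w x) (f : Cochain S i) {A : Set (Cochain S i)} {g : Cochain S i}
    (hg : g ∈ A) : wdistTo w f A ≤ wdist w f g :=
  ciInf_le ⟨0, by rintro _ ⟨g, rfl⟩; exact wnorm_nonneg hw _⟩ (⟨g, hg⟩ : A)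

theorem le_wdistTo {f : Cochain S i} {A : Set (Cochain S i)} (hA : A.Nonempty) {c : ℝ}
    (h : ∀ g ∈ A, c ≤ wdist w f g) : c ≤ wdistTo w f A := by
  have := hA.to_subtype
  exact le_ciInf fun g => h g.1 g.2

/-- Being a lower bound for the supremum suffices, whether or not it is attained: if the inequality
failed, `‖d f‖` divided by the distance would be a bound below `ε` for every admissible constant. -/
theorem mul_wdistTo_le_of_cbe {o : PosetOrientation R X} (hw : ∀ x, 0 ≤ w x) {ε : ℝ}
    (h : ENNReal.ofReal ε ≤ cbe o w S i) (f : Cochain S i) :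
    ε * wdistTo w f (coboundaries o S i : Set (Cochain S i)) ≤ wnorm w (cobd o f) := by
  by_contra hlt
  push Not at hlt
  set δ := wdistTo w f (coboundaries o S i : Set (Cochain S i)) with hδ
  have hn := wnorm_nonneg hw (cobd o f)
  have hδ0 : 0 < δ := by
    refine lt_of_le_of_ne (wdistTo_nonneg hw _ _) fun h0 => ?_
    rw [← h0, mul_zero] at hlt
    linarith
  have hlt' : wnorm w (cobd o f) / δ < ε := (div_lt_iff₀ hδ0).2 hlt
  have hle : cbe o w S i ≤ ENNReal.ofReal (wnorm w (cobd o f) / δ) := by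
    refine iSup₂_le fun μ hμ => ?_
    rw [← ENNReal.ofReal_coe_nnreal]
    exact ENNReal.ofReal_le_ofReal ((le_div_iff₀ hδ0).2 (hμ f))
  have hε : 0 < ε := lt_of_le_of_lt (by positivity) hlt'
  exact ((ENNReal.ofReal_lt_ofReal_iff hε).2 hlt').not_ge (h.trans hle)

theorem le_cse {o : PosetOrientation R X} {μ : ℝ} (hμ : 0 ≤ μ)
    (h : ∀ f : Cochain S i,
      μ * wdistTo w f (cocycles o S i : Set (Cochain S i)) ≤ wnorm w (cobd o f)) :
    ENNReal.ofReal μ ≤ cse o w S i := by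
  refine le_iSup₂_of_le (μ.toNNReal) ?_ le_rfl
  intro f
  rw [Real.coe_toNNReal _ hμ]
  exact h f

/-- A nonempty set of cochains has a member minimizing the norm of the image under any map. -/
theorem exists_min_wnorm {α : Type*} (φ : α → Cochain S i) {s : Set α} (hs : s.Nonempty) :
    ∃ a ∈ s, ∀ b ∈ s, wnorm w (φ a) ≤ wnorm w (φ b) := by
  -- There may be infinitely many cochains, but the norm depends only on the support, and there are
  -- finitely many supports.
  have hfin : ((fun a => supp (φ a)) '' s).Finite := Set.toFinite _
  obtain ⟨A, ⟨a, ha, rfl⟩, hmin⟩ :=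
    Set.exists_min_image _ (fun A : Set X => weightOf w A) hfin (hs.image _)
  exact ⟨a, ha, fun b hb => hmin _ ⟨b, hb, rfl⟩⟩

variable {d : ℕ} {n : ℤ} {F : ℕ} {D : ℝ}

theorem WeightBounds.wnorm_extendLink_le (hW : WeightBounds X d w n F D) (hi : i ≤ n) (u : X)
    (g : Cochain (S.link u) (i - dim u - 1)) : wnorm w (extendLink S u i g) ≤ D * w u := by
  refine (weightOf_mono (fun x => (hW.pos x).le) ?_).trans (hW.above_le u i hi)
  rw [← image_supp_link]
  rintro _ ⟨x, hx, rfl⟩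
  exact ⟨by rw [dim_of_mem_supp_link u hx]; omega, x.2⟩

theorem WeightBounds.wnorm_coboundary_le (hW : WeightBounds X d w n F D)
    (o : PosetOrientation R X) (hij : i + 1 = j) (hj : j ≤ n) (f : Cochain S i) :
    wnorm w (coboundary o S i j hij f) ≤ D * wnorm w f := by
  classical
  have hw0 : ∀ x, 0 ≤ w x := fun x => (hW.pos x).le
  calc wnorm w (coboundary o S i j hij f)
      ≤ ∑ x with x ∈ supp f, weightOf w {y | dim y = j ∧ x ≤ y} :=
        weightOf_biUnion_le hw0 _ _ fun y hy => by
          obtain ⟨x, hx, hxy⟩ := exists_of_mem_supp_coboundary o hij hy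
          exact ⟨x, by simpa using hx, hy.1, hxy⟩
    _ ≤ ∑ x with x ∈ supp f, D * w x := Finset.sum_le_sum fun x _ => hW.above_le x j hj
    _ = D * wnorm w f := by rw [wnorm, weightOf_eq_sum_filter, Finset.mul_sum]

theorem WeightBounds.wnorm_le (hW : WeightBounds X d w n F D) (hi : i ≤ n) (f : Cochain S i)
    (he : ∀ e : X, dim e = -1 → w e = 1) : wnorm w f ≤ D := by
  obtain ⟨e, hde, hbot⟩ := hW.exists_bot
  refine (weightOf_mono (fun x => (hW.pos x).le) fun x hx => ?_).trans
    ((hW.above_le e i hi).trans_eq (by rw [he e hde, mul_one]))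
  exact ⟨hx.1, hbot x⟩

/-- Coboundary expansion of a link bounds cochains supported above a face, as soon as they cannot
be made much smaller by coboundaries supported above that face. -/
theorem WeightBounds.local_bound (hW : WeightBounds X d w n F D) (o : PosetOrientation R X)
    (hij : i + 1 = j) (hj : j + 1 ≤ n) {u : X} {ε q : ℝ} (hε : 0 ≤ ε)
    (hcbe : ENNReal.ofReal ε ≤ cbe (o.link u) (linkWeight d w u) (S.link u) (j - dim u - 1))
    {f : Cochain S j} (hf : ∀ x ∈ supp f, u ≤ x)
    (hmin : ∀ g : Cochain (S.link u) (i - dim u - 1),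
      wnorm w f - q * w u ≤ wnorm w (f + coboundary o S i j hij (extendLink S u i g))) :
    ε * (wnorm w f - q * w u) ≤ D ^ 2 * wnorm w (cobd o f) := by
  have hD : 0 < D := zero_lt_one.trans_le hW.one_le
  have hwu := hW.pos u
  have hext := extendLink_restrictLink u f hf
  set f' := restrictLink u f with hf'
  have h1 := mul_wdistTo_le_of_cbe (hW.link_nonneg u) hcbe f'
  -- Local minimality is transported to the link: no coboundary there is close to `f'`. Passing
  -- between the weights costs one factor `D`; the second one comes from `h3`.
  have h2 : (wnorm w f - q * w u) / (D * w u) ≤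
      wdistTo (linkWeight d w u) f' (coboundaries (o.link u) (S.link u) (j - dim u - 1)) := by
    refine le_wdistTo ⟨0, Submodule.zero_mem _⟩ ?_
    rintro _ ⟨g, rfl⟩
    rw [div_le_iff₀ (by positivity)]
    -- The degree `i'` is kept variable since the definition of coboundaries uses `j - dim u - 1 -
    -- 1`, which is only propositionally `i - dim u - 1`.
    have key : ∀ (i' : ℤ) (_ : i' = i - dim u - 1) (h : i' + 1 = j - dim u - 1)
        (g : Cochain (S.link u) i'), wnorm w f - q * w u ≤
          wnorm w (extendLink S u j (f' - coboundary (o.link u) (S.link u) i' _ h g)) := by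
      rintro i' rfl h g
      rw [extendLink_sub, extendLink_coboundary o hij u g h, hext]
      have := hmin (-g)
      rwa [extendLink_neg, map_neg, ← sub_eq_add_neg] at this
    refine (key _ (by omega) (sub_add_cancel _ 1) g).trans ?_
    rw [wnorm, ← image_supp_link]
    refine (hW.le_weightOf_link u fun x hx => ?_).trans_eq (by rw [wdist, wnorm]; ring)
    rw [dim_of_mem_supp_link u hx]
    omega
  have h3 : w u * wnorm (linkWeight d w u) (cobd (o.link u) f') ≤ D * wnorm w (cobd o f) := by
    refine (hW.weightOf_link_le u fun x hx => ?_).trans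
      (mul_le_mul_of_nonneg_left (weightOf_mono (fun x => (hW.pos x).le) ?_) hD.le)
    · rw [dim_of_mem_supp_link u hx]
      omega
    · rintro _ ⟨⟨y, huy⟩, ⟨hd, hne⟩, rfl⟩
      have hy : dim y = j + 1 := by rw [dim_link] at hd; simp only at hd; omega
      refine ⟨hy, ?_⟩
      rw [cobd, ← hext, coboundary_extendLink o rfl u f' rfl hy huy hd]
      exact hne
  have h4 := (mul_le_mul_of_nonneg_left h2 hε).trans h1
  rw [mul_div_assoc', div_le_iff₀ (by positivity)] at h4
  calc _ ≤ _ := h4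
    _ = D * (w u * wnorm (linkWeight d w u) (cobd (o.link u) f')) := by ring
    _ ≤ D * (D * wnorm w (cobd o f)) := by gcongr
    _ = _ := by ring

end Norm

end Sheaf

/-! ### Vanishing of small, locally minimal cocycles. -/

section SmallCocycle

variable {R : Type v} [CommRing R] {X : Type u} [PartialOrder X] [GradeOrder ℤ X]
  {S : PosetSheaf.{u, v, w} R X}

open Classical in
/-- The part of a cochain supported on a set. -/
noncomputable def cutoff {j : ℤ} (T : Set X) (f : Cochain S j) : Cochain S j := fun x => if x.1 ∈ T then f x else 0

theorem supp_cutoff {j : ℤ} (T : Set X) (f : Cochain S j) : supp (cutoff T f) = supp f ∩ T := by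
  ext x
  constructor
  · rintro ⟨h, hx⟩
    by_cases hT : x ∈ T
    · exact ⟨⟨h, by simpa [cutoff, hT] using hx⟩, hT⟩
    · simp [cutoff, hT] at hx
  · rintro ⟨⟨h, hx⟩, hT⟩
    exact ⟨h, by simpa [cutoff, hT] using hx⟩

theorem supp_sub_cutoff {j : ℤ} (T : Set X) (f : Cochain S j) :
    supp (f - cutoff T f) = supp f \ T := by
  ext x
  constructor
  · rintro ⟨h, hx⟩
    by_cases hT : x ∈ T
    · simp [cutoff, hT] at hx
    · exact ⟨⟨h, by simpa [cutoff, hT] using hx⟩, hT⟩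
  · rintro ⟨⟨h, hx⟩, hT⟩
    exact ⟨h, by simpa [cutoff, hT] using hx⟩

variable [Fintype X] {w : X → ℝ} {d : ℕ} {n : ℤ} {F : ℕ} {D : ℝ}

theorem wnorm_eq_cutoff_add {j : ℤ} (T : Set X) (f : Cochain S j) :
    wnorm w f = wnorm w (cutoff T f) + wnorm w (f - cutoff T f) := by
  rw [wnorm, wnorm, wnorm, supp_cutoff, supp_sub_cutoff, ← weightOf_union_of_disjoint,
    Set.inter_union_sdiff]
  exact Set.disjoint_sdiff_inter.symm

/-- The total weight of the heavy faces. -/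
theorem IsHeavySet.total_le {A H : Set X} {m : ℕ} {π : ℤ → ℝ} (hH : IsHeavySet w A m π H)
    (hW : WeightBounds X d w n F D)
    (hmn : (m : ℤ) + 1 ≤ n) (hπ : ∀ r, 0 < π r) (hπm : π m ≤ 1)
    (hπmono : ∀ r l : ℤ, -1 ≤ r → r ≤ l → l ≤ m → π r ≤ π l)
    (hdim : ∀ x ∈ H, 0 ≤ dim x) :
    π 0 * weightOf w H ≤ (m + 1 : ℕ) * ((1 + F : ℝ) ^ (m + 1) * weightOf w A) := by
  have hw0 : ∀ x, 0 ≤ w x := fun x => (hW.pos x).le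
  have h1 := weightOf_biUnion_le hw0 (Finset.Icc (0 : ℤ) m) (A := H)
    (fun r => {x | x ∈ H ∧ dim x = r})
    fun x hx => ⟨dim x, Finset.mem_Icc.2 ⟨hdim x hx, hH.dim_le hx⟩, hx, rfl⟩
  calc π 0 * weightOf w H ≤ π 0 * ∑ r ∈ Finset.Icc (0 : ℤ) m, weightOf w {x | x ∈ H ∧ dim x = r} :=
        mul_le_mul_of_nonneg_left h1 (hπ 0).le
    _ = ∑ r ∈ Finset.Icc (0 : ℤ) m, π 0 * weightOf w {x | x ∈ H ∧ dim x = r} := Finset.mul_sum _ _ _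
    _ ≤ (Finset.Icc (0 : ℤ) m).card • ((1 + F : ℝ) ^ (m + 1) * weightOf w A) := by
        refine Finset.sum_le_card_nsmul _ _ _ fun r hr => ?_
        rw [Finset.mem_Icc] at hr
        refine (mul_le_mul_of_nonneg_right (hπmono 0 r (by omega) hr.1 hr.2)
          (weightOf_nonneg hw0 _)).trans (hH.weight_le' hW hmn hπ hπm (by omega) hr.2)
    _ = _ := by
        rw [nsmul_eq_mul, Int.card_Icc]
        congr 2

/-- A small cocycle which is locally minimal up to a small error vanishes. -/
theorem eq_zero_of_locally_minimal {m : ℕ} {i : ℤ} (him : i + 1 = m) {P : AbstractIntersectionProfile m}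
    (hP : P.IsProfileFor X) {π : ℤ → ℝ} {B c E ε q : ℝ} (hW : WeightBounds X d w n F D)
    (hmn : (m : ℤ) + 1 ≤ n) (hπ : ∀ r, 0 < π r) (hπm : π m ≤ 1)
    (hπmono : ∀ r l : ℤ, -1 ≤ r → r ≤ l → l ≤ m → π r ≤ π l) (hB : 0 ≤ B) (hc : 0 ≤ c)
    (hE : 0 ≤ E) (hSk : SkeletonBound w P π B c E) (o : PosetOrientation R X) (hε : 0 < ε)
    (hcbe : ∀ u : X, 0 ≤ dim u → dim u ≤ m →
      ENNReal.ofReal ε ≤ cbe (o.link u) (linkWeight d w u) (S.link u) (m - dim u - 1))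
    (hq : 0 ≤ q) (hq' : q * ((m + 1 : ℕ) * (1 + F : ℝ) ^ (m + 1)) ≤ π 0 / 4)
    (hcε : D ^ 2 * ((m + 1 : ℕ) * F) * ((m + 3 : ℕ) * (D * ((m + 2 : ℕ) ^ 3 *
      (E * (1 + 2 * B) * F * (2 * (1 + F : ℝ) ^ (m + 1)) * c)))) ≤ ε / 4)
    {f : Cochain S m} (hf : f ∈ cocycles o S m)
    (hsmall : ∀ e : X, dim e = -1 → (1 + F : ℝ) ^ (m + 1) * wnorm w f < π (-1) * w e)
    (hmin : ∀ u : X, 0 ≤ dim u → dim u ≤ i → ∀ g : Cochain (S.link u) (i - dim u - 1),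
      wnorm w f - q * w u ≤ wnorm w (f + coboundary o S i m him (extendLink S u i g))) :
    f = 0 := by
  classical
  have hw0 : ∀ x, 0 ≤ w x := fun x => (hW.pos x).le
  obtain ⟨H, hH⟩ := exists_isHeavySet w (supp f) m π
  have hdim : ∀ x ∈ H, 0 ≤ dim x := fun x hx => hH.dim_nonneg hW hmn hπ hπm hsmall hx
  have hfH : ∀ x ∈ supp f, x ∈ H := fun x hx => (hH x).2 (Or.inl ⟨hx.1, hx⟩)
  -- `T` consists of the terminal heavy faces, and `V u` of the faces from which `u` can be reached;
  -- distinct `V u` may overlap.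
  let T : Finset X := Finset.univ.filter fun u => u ∈ H ∧ ∀ z, ¬ Desc P H u z
  let V : X → Set X := fun u => {x | Relation.ReflTransGen (Desc P H) x u}
  let bad : Set X := {z | dim z = m + 1 ∧ ∃ a ≤ z, IsBad P H a}
  -- Local minimality passes to the cutoffs: the norm splits additively along a cutoff, while the
  -- triangle inequality controls the modified cochain.
  have hmin' : ∀ u ∈ T, ∀ g : Cochain (S.link u) (i - dim u - 1),
      wnorm w (cutoff (V u) f) - q * w u ≤
        wnorm w (cutoff (V u) f + coboundary o S i m him (extendLink S u i g)) := by
    intro u hu g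
    simp only [T, Finset.mem_filter, Finset.mem_univ, true_and] at hu
    have h1 : wnorm w f - q * w u ≤
        wnorm w (f + coboundary o S i m him (extendLink S u i g)) := by
      by_cases hd : dim u ≤ i
      · exact hmin u (hdim u hu.1) hd g
      -- If `dim u = m`, no `i`-face contains `u` and there is nothing to add.
      · have h0 : extendLink S u i g = 0 := by
          funext ⟨x, hx⟩
          refine extendLink_apply_of_not_le u g hx fun h => ?_
          have := dim_mono h
          omega
        rw [h0, map_zero, add_zero]
        have := mul_nonneg hq (hw0 u)
        linarith
    have h2 := wnorm_eq_cutoff_add (w := w) (V u) f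
    have h3 : f + coboundary o S i m him (extendLink S u i g) =
      (cutoff (V u) f + coboundary o S i m him (extendLink S u i g)) + (f - cutoff (V u) f) := by
      abel
    rw [h3] at h1
    have h4 := wnorm_add_le hw0 (cutoff (V u) f + coboundary o S i m him (extendLink S u i g))
      (f - cutoff (V u) f)
    linarith
  have hbad : ∀ u ∈ T, supp (cobd o (cutoff (V u) f)) ⊆ {z | z ∈ bad ∧ u ≤ z} := by
    intro u hu z hz
    simp only [T, Finset.mem_filter, Finset.mem_univ, true_and] at hu
    obtain ⟨x, hx, hxz⟩ := exists_of_mem_supp_coboundary o rfl hz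
    rw [supp_cutoff] at hx
    refine ⟨⟨hz.1, ?_⟩, (le_of_desc hx.2).trans hxz⟩
    -- Without bad subfaces of `z`, one face of `supp f` in `z` reaching `u` forces all of them to
    -- reach `u`. The cutoff then agrees with the cocycle `f` below `z`, so its coboundary vanishes
    -- there.
    by_contra hno
    push Not at hno
    obtain ⟨hdz, hne⟩ := hz
    have hdesc : ∀ x ∈ supp f, x ≤ z → Relation.ReflTransGen (Desc P H) z x := by
      intro x hx hxz
      refine .single ⟨hfH x hx, lt_of_le_of_ne hxz ?_, ?_⟩
      · rintro rfl
        have := hx.1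
        omega
      · rw [hdz, hx.1]
        exact P.ad_top
    refine hne ?_
    rw [cobd, coboundary_congr o rfl (g := f) hdz]
    · have := LinearMap.mem_ker.1 hf
      rw [this]
      rfl
    · intro y hy hyz
      by_cases hfy : f ⟨y, hy⟩ = 0
      · simp [cutoff, hfy]
      · have hyV : y ∈ V u := desc_terminal hP hW.exists_bot hno
          (hdesc y ⟨hy, hfy⟩ hyz) ((hdesc x hx.1 hxz).trans hx.2) hu.2
        simp [cutoff, hyV]
  have hlocal : ∀ u ∈ T, ε * (wnorm w (cutoff (V u) f) - q * w u) ≤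
      D ^ 2 * weightOf w {z | z ∈ bad ∧ u ≤ z} := by
    intro u hu
    have hu' := hu
    simp only [T, Finset.mem_filter, Finset.mem_univ, true_and] at hu'
    refine (hW.local_bound o him hmn hε.le (hcbe u (hdim u hu'.1) (hH.dim_le hu'.1)) ?_
      (hmin' u hu)).trans (mul_le_mul_of_nonneg_left (weightOf_mono hw0 (hbad u hu)) (sq_nonneg D))
    intro x hx
    rw [supp_cutoff] at hx
    exact le_of_desc hx.2
  have hcover : wnorm w f ≤ ∑ u ∈ T, wnorm w (cutoff (V u) f) := by
    refine weightOf_biUnion_le hw0 T (fun u => supp (cutoff (V u) f)) fun x hx => ?_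
    obtain ⟨u, hxu, hu⟩ := exists_terminal P H x
    refine ⟨u, by simp [T, mem_of_desc (hfH x hx) hxu, hu], ?_⟩
    rw [supp_cutoff]
    exact ⟨hx, hxu⟩
  -- The error terms are absorbed: terminal faces are heavy, and the total heavy weight is at most a
  -- constant times `‖f‖ / π 0`.
  have hqsum : ∑ u ∈ T, q * w u ≤ wnorm w f / 4 := by
    have h1 : ∑ u ∈ T, w u ≤ weightOf w H := by
      rw [weightOf_eq_sum_filter]
      refine Finset.sum_le_sum_of_subset_of_nonneg (fun u hu => ?_) fun x _ _ => hw0 x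
      simp only [T, Finset.mem_filter, Finset.mem_univ, true_and] at hu ⊢
      exact hu.1
    have h2 := hH.total_le hW hmn hπ hπm hπmono hdim
    have hp := hπ 0
    have hn := wnorm_nonneg hw0 f
    rw [← Finset.mul_sum]
    have h3 : π 0 * (q * weightOf w H) ≤ π 0 * (wnorm w f / 4) := by
      calc π 0 * (q * weightOf w H) = q * (π 0 * weightOf w H) := by ring
        _ ≤ q * ((m + 1 : ℕ) * ((1 + F : ℝ) ^ (m + 1) * wnorm w f)) := by
          exact mul_le_mul_of_nonneg_left h2 hq
        _ = q * ((m + 1 : ℕ) * (1 + F : ℝ) ^ (m + 1)) * wnorm w f := by ring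
        _ ≤ π 0 / 4 * wnorm w f := by gcongr
        _ = _ := by ring
    exact (mul_le_mul_of_nonneg_left h1 hq).trans (le_of_mul_le_mul_left h3 hp)
  -- A face `z` lies above at most `F` terminal faces in each of the dimensions `0, …, m`.
  have hbadsum : ∑ u ∈ T, weightOf w {z | z ∈ bad ∧ u ≤ z} ≤ ((m + 1 : ℕ) * F) * weightOf w bad := by
    refine sum_weightOf_le hw0 T bad (fun u z => u ≤ z) fun z hz => ?_
    have hsub : {u | u ∈ T ∧ u ≤ z} ⊆
        ⋃ r ∈ Finset.Icc (0 : ℤ) m, {u | dim u = r ∧ u ≤ z} := by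
      rintro u ⟨hu, huz⟩
      simp only [T, Finset.mem_filter, Finset.mem_univ, true_and] at hu
      simp only [Set.mem_iUnion, Finset.mem_Icc]
      exact ⟨dim u, ⟨hdim u hu.1, hH.dim_le hu.1⟩, rfl, huz⟩
    have h1 : ({u | u ∈ T ∧ u ≤ z}.ncard) ≤ (m + 1) * F := by
      refine (Set.ncard_le_ncard hsub (Set.toFinite _)).trans
        ((Finset.set_ncard_biUnion_le _ _).trans ?_)
      refine (Finset.sum_le_card_nsmul _ _ F fun r _ => hW.ncard_le z (by rw [hz.1]; exact hmn) r).trans ?_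
      rw [smul_eq_mul, Int.card_Icc]
      have : ((m : ℤ) + 1 - 0).toNat = m + 1 := by omega
      rw [this]
    exact_mod_cast h1
  have hbadle := weightOf_above_bad_le hP hH hW hmn hπ hπm hπmono hB hc hE hSk
  have hfinal : ε * wnorm w f - ε * (wnorm w f / 4) ≤ ε / 4 * wnorm w f := by
    calc ε * wnorm w f - ε * (wnorm w f / 4)
        ≤ ε * (∑ u ∈ T, wnorm w (cutoff (V u) f)) - ε * ∑ u ∈ T, q * w u := by gcongr
      _ = ∑ u ∈ T, ε * (wnorm w (cutoff (V u) f) - q * w u) := by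
        rw [← mul_sub, ← Finset.sum_sub_distrib, Finset.mul_sum]
      _ ≤ ∑ u ∈ T, D ^ 2 * weightOf w {z | z ∈ bad ∧ u ≤ z} := Finset.sum_le_sum hlocal
      _ = D ^ 2 * ∑ u ∈ T, weightOf w {z | z ∈ bad ∧ u ≤ z} := by rw [Finset.mul_sum]
      _ ≤ D ^ 2 * (((m + 1 : ℕ) * F) * weightOf w bad) := by gcongr
      _ ≤ D ^ 2 * (((m + 1 : ℕ) * F) * ((m + 3 : ℕ) * (D * ((m + 2 : ℕ) ^ 3 *
          (E * (1 + 2 * B) * F * (2 * (1 + F : ℝ) ^ (m + 1)) * c * wnorm w f))))) := by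
        gcongr
        exact hbadle
      _ = (D ^ 2 * ((m + 1 : ℕ) * F) * ((m + 3 : ℕ) * (D * ((m + 2 : ℕ) ^ 3 *
          (E * (1 + 2 * B) * F * (2 * (1 + F : ℝ) ^ (m + 1)) * c))))) * wnorm w f := by ring
      _ ≤ ε / 4 * wnorm w f := mul_le_mul_of_nonneg_right hcε (wnorm_nonneg hw0 f)
  refine eq_zero_of_wnorm_le_zero hW.pos (not_lt.1 fun hpos => ?_)
  have := mul_pos hε hpos
  linarith

end SmallCocycle

/-! ### From skeleton expansion to the threshold form. -/

section Skeleton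

variable {X : Type u} [PartialOrder X] [GradeOrder ℤ X] [Fintype X]

/-- If the bottom face is an infimum of a pair, it is the only one, so the pair is related. The
halved vertex weights for `i ≠ j` are simply estimated by the full ones. -/
theorem weightOf_le_of_skeletonExpander {w : X → ℝ} (hw : ∀ x, 0 ≤ w x) {i j k : ℤ} {α β : ℝ}
    (hα : 0 ≤ α) (hβ : 0 ≤ β) (h : (noIntersection w i j k).IsSkeletonExpander α β) {e : X}
    (he : IsBot e) {A : Set X} (hA : ∀ x ∈ A, dim x = i ∨ dim x = j) :
    weightOf w {z | dim z = k ∧ ∃ x ∈ A, ∃ y ∈ A, x ≠ y ∧ x ≤ z ∧ y ≤ z ∧ e ∈ infima {x, y} ∧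
      dim x = i ∧ dim y = j} ≤ α * weightOf w A + β * weightOf w A ^ 2 := by
  let A' : Set {x : X // dim x = i ∨ dim x = j} := {x | x.1 ∈ A}
  have hE : weightOf w {z | dim z = k ∧ ∃ x ∈ A, ∃ y ∈ A, x ≠ y ∧ x ≤ z ∧ y ≤ z ∧
      e ∈ infima {x, y} ∧ dim x = i ∧ dim y = j} ≤
      weightOf (noIntersection w i j k).wE ((noIntersection w i j k).E₂ A') := by
    refine (weightOf_mono hw ?_).trans
      (weightOf_image (φ := (Subtype.val : {z : X // dim z = k} → X)) Subtype.val_injective w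
        ((noIntersection w i j k).E₂ A')).le
    rintro z ⟨hz, x, hx, y, hy, hne, hxz, hyz, hinf, hdx, hdy⟩
    exact ⟨⟨z, hz⟩, ⟨⟨x, hA x hx⟩, hx, ⟨y, hA y hy⟩, hy, fun h => hne (congrArg Subtype.val h),
      hxz, hyz, ⟨⟨z, hz⟩, hxz, hyz⟩, ⟨e, he, infima_eq_of_isBot he hinf⟩, Or.inl ⟨hdx, hdy⟩⟩, rfl⟩
  have hV : weightOf (noIntersection w i j k).wV A' ≤ weightOf w A := by
    calc _ ≤ 1 * weightOf (fun x : {x : X // dim x = i ∨ dim x = j} => w x.1) A' :=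
          weightOf_le_mul fun x _ => by
            have := hw x.1
            simp only [noIntersection]
            split_ifs <;> linarith
      _ = weightOf w (Subtype.val '' A') := by
          rw [one_mul, weightOf_image Subtype.val_injective]
      _ ≤ weightOf w A := weightOf_mono hw (by rintro _ ⟨x, hx, rfl⟩; exact hx)
  have hV0 : 0 ≤ weightOf (noIntersection w i j k).wV A' := weightOf_nonneg (fun x => by
    have := hw x.1
    simp only [noIntersection]
    split_ifs <;> linarith) A'
  refine hE.trans ((h A').trans ?_)
  gcongr

variable {d : ℕ} {w : X → ℝ} {n : ℤ} {F : ℕ} {D : ℝ}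

/-- Up to factors `D`, link weights are weights of `X` divided by `w v`. Multiplying by `w v`
therefore leaves one division by `w v` in the quadratic term. Its three factors `D` come from the
hyperedges and, twice, from `A`. -/
theorem WeightBounds.weightOf_le_of_skeletonExpander_link (hW : WeightBounds X d w n F D)
    {v : X} {l r t : ℤ} {α β : ℝ} (hα : 0 ≤ α) (hβ : 0 ≤ β)
    (h : (noIntersectionLink d w v l r t).IsSkeletonExpander α β) (ht : t ≤ n) (hl : l ≤ n)
    (hr : r ≤ n) {A : Set X} (hA : ∀ x ∈ A, v ≤ x ∧ (dim x = l ∨ dim x = r)) :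
    weightOf w {z | dim z = t ∧ ∃ x ∈ A, ∃ y ∈ A, x ≠ y ∧ x ≤ z ∧ y ≤ z ∧ v ∈ infima {x, y} ∧
      dim x = l ∧ dim y = r} ≤ D ^ 3 * (α * weightOf w A + β * weightOf w A ^ 2 / w v) := by
  have hw0 : ∀ x, 0 ≤ w x := fun x => (hW.pos x).le
  have hD := hW.one_le
  have hwv := hW.pos v
  let A' : Set (Link v) := {x | x.1 ∈ A}
  let Z : Set (Link v) := {z | dim z = t - dim v - 1 ∧ ∃ x ∈ A', ∃ y ∈ A', x ≠ y ∧ x ≤ z ∧ y ≤ z ∧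
    (⟨v, le_rfl⟩ : Link v) ∈ infima {x, y} ∧ dim x = l - dim v - 1 ∧ dim y = r - dim v - 1}
  have h1 := weightOf_le_of_skeletonExpander (hW.link_nonneg v) hα hβ h
    (e := (⟨v, le_rfl⟩ : Link v)) (fun x => x.2) (A := A') fun x hx => by
      rw [dim_link]
      rcases (hA x.1 hx).2 with h | h
      · exact Or.inl (by rw [h])
      · exact Or.inr (by rw [h])
  have h2 : weightOf w {z | dim z = t ∧ ∃ x ∈ A, ∃ y ∈ A, x ≠ y ∧ x ≤ z ∧ y ≤ z ∧
      v ∈ infima {x, y} ∧ dim x = l ∧ dim y = r} ≤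
      D * (w v * weightOf (linkWeight d w v) Z) := by
    refine (weightOf_mono hw0 ?_).trans (hW.le_weightOf_link v fun z hz => ?_)
    · rintro z ⟨hz, x, hx, y, hy, hne, hxz, hyz, hinf, hdx, hdy⟩
      have hvx := (hA x hx).1
      have hvy := (hA y hy).1
      refine ⟨⟨z, hvx.trans hxz⟩, ⟨?_, ⟨x, hvx⟩, hx, ⟨y, hvy⟩, hy, ?_, hxz, hyz,
        mem_infima_link hvx hvy hinf, ?_, ?_⟩, rfl⟩
      · rw [dim_link, hz]
      · exact fun h => hne (congrArg Subtype.val h)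
      · rw [dim_link, hdx]
      · rw [dim_link, hdy]
    · have := hz.1
      rw [dim_link] at this
      omega
  have h3 : w v * weightOf (linkWeight d w v) A' ≤ D * weightOf w A := by
    refine (hW.weightOf_link_le v fun x hx => ?_).trans
      (mul_le_mul_of_nonneg_left (weightOf_mono hw0 (by rintro _ ⟨x, hx, rfl⟩; exact hx))
        (by linarith))
    rcases (hA x.1 hx).2 with h | h <;> omega
  have h4 := weightOf_nonneg (hW.link_nonneg v) A'
  have h5 := weightOf_nonneg hw0 A
  have h1' : weightOf (linkWeight d w v) Z ≤ α * weightOf (linkWeight d w v) A' +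
    β * weightOf (linkWeight d w v) A' ^ 2 := h1
  generalize weightOf (linkWeight d w v) A' = a at *
  generalize weightOf w A = a' at *
  calc _ ≤ _ := h2
    _ ≤ D * (w v * (α * a + β * a ^ 2)) := by gcongr
    _ = D * (α * (w v * a) + β * (w v * a) ^ 2 / w v) := by
      field_simp
    _ ≤ D * (α * (D * a') + β * (D * a') ^ 2 / w v) := by gcongr
    _ = D ^ 2 * (α * a') + D ^ 3 * (β * a' ^ 2 / w v) := by ring
    _ ≤ D ^ 3 * (α * a') + D ^ 3 * (β * a' ^ 2 / w v) := by
      gcongr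
      norm_num
    _ = _ := by ring

/-- The thresholds of the expansion argument. -/
noncomputable def threshold (c B' : ℝ) (m r : ℤ) : ℝ :=
  c ^ (2 ^ (m - r).toNat - 1) * if r < 0 then B'⁻¹ else 1

/-! ### Arithmetic of the thresholds. -/

section Threshold

variable {c B' : ℝ}

theorem threshold_pos (hc : 0 < c) (hB' : 1 ≤ B') (m r : ℤ) : 0 < threshold c B' m r := by
  unfold threshold
  have : 0 < B' := by linarith
  split_ifs <;> positivity

theorem threshold_mono (hc : 0 < c) (hc1 : c ≤ 1) (hB' : 1 ≤ B') (m : ℤ) {r l : ℤ} (h : r ≤ l) :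
    threshold c B' m r ≤ threshold c B' m l := by
  have hB0 : 0 < B' := by linarith
  have hB1 : B'⁻¹ ≤ 1 := inv_le_one_of_one_le₀ hB'
  have h1 : c ^ (2 ^ (m - r).toNat - 1) ≤ c ^ (2 ^ (m - l).toNat - 1) := by
    refine pow_le_pow_of_le_one hc.le hc1 (Nat.sub_le_sub_right ?_ 1)
    exact Nat.pow_le_pow_right (by norm_num) (by omega)
  unfold threshold
  refine mul_le_mul h1 ?_ ?_ (by positivity)
  · split_ifs with h1 h2 h2
    · exact le_rfl
    · exact hB1
    · omega
    · exact le_rfl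
  · split_ifs <;> positivity

theorem threshold_of_nonneg {m r : ℤ} (hr : 0 ≤ r) :
    threshold c B' m r = c ^ (2 ^ (m - r).toNat - 1) := by
  rw [threshold, if_neg (by omega), mul_one]

/-- The exponent on the right is `2 ^ (m - r)`, so equality holds for `m = k + 1`; `m = k` leaves
room. -/
theorem le_mul_threshold (hc : 0 < c) (hc1 : c ≤ 1) {m k r : ℤ} (hr : 0 ≤ r) (hm : m ≤ k + 1) :
    c ^ (2 ^ (k + 1 - r).toNat) ≤ c * threshold c B' m r := by
  rw [threshold_of_nonneg hr, ← pow_succ']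
  refine pow_le_pow_of_le_one hc.le hc1 ?_
  have h1 : 1 ≤ 2 ^ (m - r).toNat := Nat.one_le_two_pow
  have h2 : 2 ^ (m - r).toNat ≤ 2 ^ (k + 1 - r).toNat := Nat.pow_le_pow_right (by norm_num) (by omega)
  omega

/-- Put `a = m - r` and `s = r - 1 - b`. In the worst case `m = k` the exponents agree exactly: `2 ^
(a + s + 1) - 1 - 2 ^ (a + 1) * (2 ^ s - 1) = 2 ^ (a + 1) - 1`. This identity dictates the shape of
the exponents in the hypotheses. -/
theorem zpow_mul_threshold_le (hc : 0 < c) (hc1 : c ≤ 1) {m k r b : ℤ} (hb : -1 ≤ b) (hbr : b < r)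
    (hrm : r ≤ m) (hm : k ≤ m) :
    c ^ (-(2 ^ (k + 1 - r).toNat * (2 ^ (r - 1 - b).toNat - 1)) : ℤ) *
      c ^ (2 ^ (m - b).toNat - 1) ≤ c * threshold c B' m r ^ 2 := by
  rw [threshold_of_nonneg (by omega)]
  obtain ⟨a, ha⟩ : ∃ a, (m - r).toNat = a := ⟨_, rfl⟩
  obtain ⟨s, hs⟩ : ∃ s, (r - 1 - b).toNat = s := ⟨_, rfl⟩
  have h1 : (m - b).toNat = a + s + 1 := by omega
  have h2 : (k + 1 - r).toNat ≤ a + 1 := by omega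
  generalize (k + 1 - r).toNat = a' at *
  rw [ha, hs, h1]
  have h3 : (-(2 ^ a' * (2 ^ s - 1)) : ℤ) = -((2 ^ a' * (2 ^ s - 1) : ℕ) : ℤ) := by
    rw [Nat.cast_mul, Nat.cast_sub Nat.one_le_two_pow]
    push_cast
    ring
  rw [h3, zpow_neg, zpow_natCast, inv_mul_le_iff₀ (by positivity), ← pow_mul, ← pow_succ',
    ← pow_add]
  refine pow_le_pow_of_le_one hc.le hc1 ?_
  have h4 : 2 ^ a' ≤ 2 ^ (a + 1) := Nat.pow_le_pow_right (by norm_num) h2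
  have h5 : 1 ≤ 2 ^ s := Nat.one_le_two_pow
  have h6 : 1 ≤ 2 ^ a := Nat.one_le_two_pow
  have h7 : 2 ^ (a + s + 1) = 2 ^ (a + 1) * (2 ^ s - 1) + 2 ^ (a + 1) := by
    rw [Nat.mul_sub, mul_one, Nat.sub_add_cancel (Nat.le_mul_of_pos_right _ (by omega)), ← pow_add]
    ring_nf
  have h8 : 2 ^ a' * (2 ^ s - 1) ≤ 2 ^ (a + 1) * (2 ^ s - 1) := Nat.mul_le_mul_right _ h4
  have h9 : 2 ^ (a + 1) = 2 * 2 ^ a := pow_succ' 2 a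
  omega

end Threshold

/-- The skeleton expansion hypotheses of the main theorem, expressed by the weights of `X`. -/
theorem skeletonBound_of_isSkeletonExpander (hW : WeightBounds X d w n F D)
    (hw1 : ∀ e : X, dim e = -1 → w e = 1) {m k : ℕ} (hkm : k ≤ m) (hmk : m ≤ k + 1)
    (hmn : (m : ℤ) + 1 ≤ n) (P : AbstractIntersectionProfile m) {B B' c : ℝ} (hB : 0 ≤ B)
    (hB' : 1 ≤ B') (hc : 0 < c) (hc1 : c ≤ 1)
    (h2a : ∀ t l r b : ℤ, (t, l, r, b) ∈ P.quads → -1 < b → ∀ z : X, dim z = b →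
      (noIntersectionLink d w z l r t).IsSkeletonExpander (c ^ (2 ^ (k + 1 - r).toNat))
        (B * c ^ (-(2 ^ (k + 1 - r).toNat * (2 ^ (r - 1 - b).toNat - 1)) : ℤ)))
    (h2b : ∀ t l r b : ℤ, (t, l, r, b) ∈ P.quads → b = -1 →
      (noIntersection w l r t).IsSkeletonExpander (c ^ (2 ^ (k + 1 - r).toNat))
        (B' * B * c ^ (-(2 ^ (k + 1 - r).toNat * (2 ^ r.toNat - 1)) : ℤ))) :
    SkeletonBound w P (threshold c B' m) B c (D ^ 3) := by
  intro t l r b hq v hv A hA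
  obtain ⟨q1, q2, q3, q4, q5⟩ := P.quads_range _ _ _ _ hq
  have hw0 : ∀ x, 0 ≤ w x := fun x => (hW.pos x).le
  have hwv := hW.pos v
  have hA0 := weightOf_nonneg hw0 A
  have hD := hW.one_le
  have hα := le_mul_threshold (B' := B') hc hc1 (m := m) (k := k) (r := r) (by omega) (by omega)
  have hβ := zpow_mul_threshold_le (B' := B') hc hc1 (m := m) (k := k) q5 q4 (by omega) (by omega)
  have hpb := threshold_pos hc hB' m b
  have hB0 : 0 < B' := by linarith
  by_cases hb : -1 < b
  · refine (hW.weightOf_le_of_skeletonExpander_link (by positivity) (by positivity)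
      (h2a t l r b hq hb v hv) (by omega) (by omega) (by omega) hA).trans ?_
    have h1 : B * c ^ (-(2 ^ (k + 1 - r).toNat * (2 ^ (r - 1 - b).toNat - 1)) : ℤ) ≤
        B * c * threshold c B' m r ^ 2 / threshold c B' m b := by
      rw [le_div_iff₀ hpb, threshold_of_nonneg (r := b) (by omega), mul_assoc, mul_assoc]
      exact mul_le_mul_of_nonneg_left hβ hB
    gcongr
  · have hb' : b = -1 := by omega
    subst hb'
    have hbot : IsBot v := by
      obtain ⟨e, hde, he⟩ := hW.exists_bot
      rw [← eq_of_le_of_dim_eq (he v) (hde.trans hv.symm)]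
      exact he
    refine (weightOf_le_of_skeletonExpander hw0 (by positivity) (by positivity)
      (h2b t l r _ hq rfl) hbot fun x hx => (hA x hx).2).trans ?_
    have h1 : B' * B * c ^ (-(2 ^ (k + 1 - r).toNat * (2 ^ r.toNat - 1)) : ℤ) ≤
        B * c * threshold c B' m r ^ 2 / threshold c B' m (-1) := by
      rw [le_div_iff₀ hpb]
      have h2 : r - 1 - -1 = r := by ring
      rw [h2] at hβ
      -- The factor `B'⁻¹` in the threshold of dimension `-1` is there to cancel the `B'` of the
      -- hypothesis on `X` itself.
      have h3 : threshold c B' m (-1) = c ^ (2 ^ ((m : ℤ) - -1).toNat - 1) * B'⁻¹ := by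
        rw [threshold, if_pos (by norm_num)]
      rw [h3, mul_assoc B c]
      refine le_trans (le_of_eq ?_) (mul_le_mul_of_nonneg_left hβ hB)
      field_simp
    rw [hw1 v hv, div_one]
    have h4 : 0 ≤ c * threshold c B' m r * weightOf w A + B * c * threshold c B' m r ^ 2 /
        threshold c B' m (-1) * weightOf w A ^ 2 := by
      have := threshold_pos hc hB' m r
      positivity
    refine le_trans ?_ (le_mul_of_one_le_left h4 (one_le_pow₀ hD))
    gcongr

/-- The empty face is the only face of its dimension and lies below every top face, so properness
gives it the whole top weight. -/
theorem weight_eq_one_of_dim (hX : IsDPoset X d) (hw : IsProperWeight d w) {e : X}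
    (he : dim e = -1) : w e = 1 := by
  have hbot := hX.isBot_of_dim_eq he
  have h1 : ∀ y : X, {x' : X | dim x' = dim e ∧ x' ≤ y} = {e} := fun y => by
    ext x
    constructor
    · rintro ⟨h, -⟩
      exact (eq_of_le_of_dim_eq (hbot x) h.symm).symm
    · rintro rfl
      exact ⟨rfl, hbot y⟩
  have h2 : {y : X | dim y = d ∧ e ≤ y} = {y : X | dim y = d} :=
    Set.ext fun y => and_iff_left (hbot y)
  rw [hw.proper e, h2, ← hw.total]
  simp only [h1, Set.ncard_singleton, Nat.cast_one, div_one]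

end Skeleton

/-! ### The correction algorithm. -/

section Correction

variable {R : Type v} [CommRing R] {X : Type u} [PartialOrder X] [GradeOrder ℤ X] [Fintype X]
  {S : PosetSheaf.{u, v, w} R X} {w : X → ℝ} {d : ℕ} {n : ℤ} {F : ℕ} {D q : ℝ} {k : ℤ}
  {o : PosetOrientation R X}

theorem cobd_add {i : ℤ} (f g : Cochain S i) : cobd o (f + g) = cobd o f + cobd o g :=
  map_add _ f g

theorem CorrectionStep.lt (hw : ∀ x, 0 < w x) (hq : 0 ≤ q) {f f' : Cochain S k}
    (h : CorrectionStep o w S k q f f') : wnorm w (cobd o f') < wnorm w (cobd o f) := by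
  obtain ⟨z, -, -, g, hlt, rfl⟩ := h
  rw [cobd_add]
  have := mul_nonneg hq (hw z).le
  linarith

/-- The norm of the coboundary strictly decreases, yet takes only finitely many values because it is
determined by a support. -/
theorem correctionTerminates (hw : ∀ x, 0 < w x) (hq : 0 ≤ q) (f : Cochain S k) :
    CorrectionTerminates o w S k q f := by
  rintro ⟨s, -, hs⟩
  have hanti : StrictAnti fun n => wnorm w (cobd o (s n)) :=
    strictAnti_nat_of_succ_lt fun n => (hs n).lt hw hq
  refine not_injective_infinite_finite (fun n => supp (cobd o (s n))) fun a b hab => ?_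
  exact hanti.injective (congrArg (weightOf w) hab)

theorem exists_correctionOutput (hw : ∀ x, 0 < w x) (hq : 0 ≤ q) (f : Cochain S k) :
    ∃ f', CorrectionOutput o w S k q f f' := by
  obtain ⟨f', hf', hmin⟩ := exists_min_wnorm (w := w) (fun f' : Cochain S k => cobd o f')
    (s := {f' | Relation.ReflTransGen (CorrectionStep o w S k q) f f'}) ⟨f, .refl⟩
  exact ⟨f', hf', fun f'' h => (hmin f'' (Relation.ReflTransGen.tail hf' h)).not_gt (h.lt hw hq)⟩

/-- The distance travelled by the correction algorithm is controlled by the decrease of the norm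
of the coboundary. -/
theorem WeightBounds.correction_dist_le (hW : WeightBounds X d w n F D) (hk : k ≤ n) (hq : 0 ≤ q)
    {f f' : Cochain S k} (h : Relation.ReflTransGen (CorrectionStep o w S k q) f f') :
    q * wdist w f f' ≤ D * (wnorm w (cobd o f) - wnorm w (cobd o f')) := by
  have hw0 : ∀ x, 0 ≤ w x := fun x => (hW.pos x).le
  have hD : 0 ≤ D := zero_le_one.trans hW.one_le
  induction h with
  | refl => simp [wdist, wnorm_zero]
  | @tail b c _ hstep ih =>
    obtain ⟨z, -, -, g, hlt, rfl⟩ := hstep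
    rw [← cobd_add] at hlt
    -- A step at `z` moves the cochain by at most `D * w z` and lowers the norm of the coboundary by
    -- more than `q * w z`.
    have h1 : wdist w f (b + extendLink S z k g) ≤ wdist w f b + wnorm w (extendLink S z k g) := by
      rw [wdist, wdist, ← wnorm_neg (extendLink S z k g), ← sub_sub, sub_eq_add_neg (f - b)]
      exact wnorm_add_le hw0 _ _
    have h2 := hW.wnorm_extendLink_le hk z g
    have h3 : q * wdist w f (b + extendLink S z k g) ≤ q * wdist w f b + D * (q * w z) := by
      calc _ ≤ q * (wdist w f b + D * w z) := by gcongr; linarith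
        _ = _ := by ring
    have h4 : D * (q * w z) ≤
        D * (wnorm w (cobd o b) - wnorm w (cobd o (b + extendLink S z k g))) := by
      gcongr
      linarith
    linarith

theorem WeightBounds.wnorm_cobd_le_wdistTo (hW : WeightBounds X d w n F D) (hk : k + 1 ≤ n)
    (f : Cochain S k) :
    wnorm w (cobd o f) ≤ D * wdistTo w f (cocycles o S k : Set (Cochain S k)) := by
  have hD : 0 < D := zero_lt_one.trans_le hW.one_le
  rw [← div_le_iff₀' hD]
  refine le_wdistTo ⟨0, Submodule.zero_mem _⟩ fun z hz => ?_
  rw [div_le_iff₀' hD]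
  have h1 : cobd o f = coboundary o S k (k + 1) rfl (f - z) := by
    rw [map_sub, LinearMap.mem_ker.1 hz, sub_zero]
    rfl
  rw [h1]
  exact hW.wnorm_coboundary_le o rfl hk (f - z)

/-- Expansion from the correction algorithm: if stuck cochains with small coboundary are cocycles,
then the algorithm corrects cochains with small coboundary. -/
theorem WeightBounds.correction (hW : WeightBounds X d w n F D) (hk : k ≤ n) (hq : 0 < q) {θ : ℝ}
    (hstuck : ∀ f : Cochain S k, wnorm w (cobd o f) < θ →
      (∀ f', ¬ CorrectionStep o w S k q f f') → f ∈ cocycles o S k)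
    {f f' : Cochain S k} (hf : wnorm w (cobd o f) < θ) (h : CorrectionOutput o w S k q f f') :
    f' ∈ cocycles o S k ∧ q * wdist w f f' ≤ D * wnorm w (cobd o f) := by
  have hw0 : ∀ x, 0 ≤ w x := fun x => (hW.pos x).le
  have hD : 0 < D := zero_lt_one.trans_le hW.one_le
  have h1 := hW.correction_dist_le hk hq.le h.1
  have h2 : 0 ≤ q * wdist w f f' := mul_nonneg hq.le (wnorm_nonneg hw0 _)
  -- The output has no larger coboundary norm than the input, so it still lies below `θ`.
  have h3 := nonneg_of_mul_nonneg_right (h2.trans h1) hD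
  have h4 := mul_nonneg hD.le (wnorm_nonneg hw0 (cobd o f'))
  exact ⟨hstuck f' (by linarith) h.2, by linarith⟩

theorem le_ccd {i : ℤ} {μ : ℝ} (h : ∀ f ∈ cocycles o S i, wnorm w f < μ → f ∈ coboundaries o S i) :
    ENNReal.ofReal μ ≤ ccd o w S i :=
  le_iInf₂ fun f hf => ENNReal.ofReal_le_ofReal (not_lt.1 fun hlt => hf.2 (h f hf.1 hlt))

end Correction

/-- The coefficient of the bound on the failure of local coboundary conditions. -/
noncomputable def badConst (B : ℝ) (F m : ℕ) (D : ℝ) : ℝ :=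
  D ^ 2 * ((m + 1 : ℕ) * F) * ((m + 3 : ℕ) * (D * ((m + 2 : ℕ) ^ 3 *
    (D ^ 3 * (1 + 2 * B) * F * (2 * (1 + F : ℝ) ^ (m + 1))))))

theorem badConst_nonneg {B D : ℝ} (hB : 0 ≤ B) (hD : 0 ≤ D) (F m : ℕ) : 0 ≤ badConst B F m D := by
  unfold badConst
  positivity

/-! ### Choice of constants and the main theorem. -/

section Main

variable {R : Type v} [CommRing R] {X : Type u} [PartialOrder X] [GradeOrder ℤ X] [Fintype X]
  {S : PosetSheaf.{u, v, w} R X} {w : X → ℝ} {d : ℕ} {n : ℤ} {F : ℕ} {D q : ℝ}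
  {o : PosetOrientation R X}

/-- `eq_zero_of_locally_minimal` with the concrete thresholds. -/
theorem eq_zero_of_small {m : ℕ} {i j : ℤ} (hij : i + 1 = j) (hj : j = m) {P : AbstractIntersectionProfile m}
    (hP : P.IsProfileFor X) {B B' c K ε : ℝ} (hW : WeightBounds X d w n F D)
    (hw1 : ∀ e : X, dim e = -1 → w e = 1) (hmn : (m : ℤ) + 1 ≤ n) (hB : 0 ≤ B) (hB' : 1 ≤ B')
    (hcK : c = K * ε) (hc : 0 < c) (hc1 : c ≤ 1) (hε : 0 < ε)
    (hK : K * badConst B F m D ≤ 1 / 4)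
    (hSk : SkeletonBound w P (threshold c B' m) B c (D ^ 3))
    (hcbe : ∀ u : X, 0 ≤ dim u → dim u ≤ m →
      ENNReal.ofReal ε ≤ cbe (o.link u) (linkWeight d w u) (S.link u) (j - dim u - 1))
    (hq : 0 ≤ q) (hq' : q * ((m + 1 : ℕ) * (1 + F : ℝ) ^ (m + 1)) ≤ c ^ (2 ^ m - 1) / 4)
    {f : Cochain S j} (hf : f ∈ cocycles o S j)
    (hsmall : (1 + F : ℝ) ^ (m + 1) * wnorm w f < B'⁻¹ * c ^ (2 ^ (m + 1) - 1))
    (hmin : ∀ u : X, 0 ≤ dim u → dim u ≤ i → ∀ g : Cochain (S.link u) (i - dim u - 1),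
      wnorm w f - q * w u ≤ wnorm w (f + coboundary o S i j hij (extendLink S u i g))) :
    f = 0 := by
  -- The degree `j` is separate from `m` because `cobd` lands in degree `(k : ℤ) + 1`, not in the
  -- cast of `k + 1`.
  subst hj
  have hD : 0 ≤ D := zero_le_one.trans hW.one_le
  have h0 : threshold c B' m 0 = c ^ (2 ^ m - 1) := by
    rw [threshold_of_nonneg le_rfl]
    simp
  have hm1 : threshold c B' m m = 1 := by
    rw [threshold_of_nonneg (by omega)]
    simp
  have hneg : threshold c B' m (-1) = B'⁻¹ * c ^ (2 ^ (m + 1) - 1) := by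
    rw [threshold, if_pos (by norm_num), mul_comm]
    have : ((m : ℤ) - -1).toNat = m + 1 := by omega
    rw [this]
  refine eq_zero_of_locally_minimal hij hP hW hmn (threshold_pos hc hB' m) hm1.le
    (fun r l _ h _ => threshold_mono hc hc1 hB' m h) hB hc.le (by positivity) hSk o hε hcbe hq
    (by rw [h0]; exact hq') ?_ hf (fun e he => by rw [hneg, hw1 e he, mul_one]; exact hsmall) hmin
  -- The bad weight carries a factor `c = K * ε`; its `ε` matches the expansion of the links, and
  -- `K` absorbs all constants.
  calc _ = ε * (K * badConst B F m D) := by rw [hcK, badConst]; ring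
    _ ≤ ε * (1 / 4) := by gcongr
    _ = ε / 4 := by ring

end Main

end PosetExp

theorem mainTheorem2 (B : ℝ) (hB : 0 ≤ B) (F : ℕ) (L : ℝ) (hL : 1 ≤ L) (k : ℕ) :
    ∃ K K' : ℝ, 0 < K ∧ K ≤ 1 ∧ 0 < K' ∧ K' ≤ 1 ∧
      ∀ (R : Type v) [CommRing R] (d : ℕ), k + 2 ≤ d →
      ∀ (X : Type u) [PartialOrder X] [GradeOrder ℤ X] [Fintype X], IsDPoset X d →
      ∀ (w : X → ℝ), IsProperWeight d w →
      ∀ (o : PosetOrientation R X),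
        lowerIrregularity X d ≤ L →
        (∀ i j : ℤ, -1 ≤ i → i ≤ j → j ≤ k + 2 → Fmax X (-1) i j ≤ F) →
      ∀ (P : AbstractIntersectionProfile k), P.IsProfileFor X →
      ∀ (P' : AbstractIntersectionProfile (k + 1)), P'.IsProfileFor X →
      ∀ (S : PosetSheaf.{u, v, w} R X) (ε B' : ℝ), 0 < ε → ε ≤ 1 → 1 ≤ B' →
        -- condition (1a)
        (∀ z : X, 0 ≤ dim z → dim z ≤ k →
          ENNReal.ofReal ε ≤ cbe (o.link z) (linkWeight d w z) (S.link z) (k - dim z - 1)) →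
        -- condition (1b)
        (∀ z : X, 0 ≤ dim z → dim z ≤ k + 1 →
          ENNReal.ofReal ε ≤ cbe (o.link z) (linkWeight d w z) (S.link z) (k - dim z)) →
        -- condition (2a)
        (∀ t l r b : ℤ, (t, l, r, b) ∈ P.quads ∪ P'.quads → -1 < b →
          ∀ z : X, dim z = b →
            (noIntersectionLink d w z l r t).IsSkeletonExpander
              ((K * ε) ^ (2 ^ (k + 1 - r).toNat))
              (B * (K * ε) ^
                (-(2 ^ (k + 1 - r).toNat * (2 ^ (r - 1 - b).toNat - 1)) : ℤ))) →
        -- condition (2b)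
        (∀ t l r b : ℤ, (t, l, r, b) ∈ P.quads ∪ P'.quads → b = -1 →
          (noIntersection w l r t).IsSkeletonExpander
            ((K * ε) ^ (2 ^ (k + 1 - r).toNat))
            (B' * B * (K * ε) ^
              (-(2 ^ (k + 1 - r).toNat * (2 ^ r.toNat - 1)) : ℤ))) →
        ENNReal.ofReal (B'⁻¹ * K' * (K * ε) ^ (2 ^ (k + 2) - 1)) ≤ cse o w S k ∧
        ENNReal.ofReal (B'⁻¹ * K' * (K * ε) ^ (2 ^ (k + 1) - 1)) ≤ ccd o w S k ∧
        ∀ f : Cochain S k,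
          wdistTo w f (cocycles o S k : Set (Cochain S k)) <
              B'⁻¹ * K' * (K * ε) ^ (2 ^ (k + 2) - 1) →
          CorrectionTerminates o w S k (K * (K * ε) ^ (2 ^ (k + 1) - 1)) f ∧
          ∀ f' : Cochain S k,
            CorrectionOutput o w S k (K * (K * ε) ^ (2 ^ (k + 1) - 1)) f f' →
            f' ∈ cocycles o S k ∧
            wdist w f f' ≤ K'⁻¹ * ((K * ε) ^ (2 ^ (k + 1)))⁻¹ *
              wdistTo w f (cocycles o S k : Set (Cochain S k)) := by
  have hF0 : (0 : ℝ) ≤ F := Nat.cast_nonneg F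
  obtain ⟨D, hDdef⟩ : ∃ D, D = L ^ 3 * ((F : ℝ) + 1) := ⟨_, rfl⟩
  have hD1 : 1 ≤ D := by
    have := one_le_pow₀ hL (n := 3)
    rw [hDdef]
    nlinarith
  have hD0 : 0 < D := by linarith
  obtain ⟨G, hG⟩ : ∃ G : ℝ, G = (1 + F : ℝ) ^ (k + 2) := ⟨_, rfl⟩
  have hG1 : 1 ≤ G := hG ▸ one_le_pow₀ (by linarith)
  have hG0 : 0 < G := by linarith
  have hc0 := badConst_nonneg hB hD0.le F k
  have hc1 := badConst_nonneg hB hD0.le F (k + 1)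
  -- `M` dominates everything that `K = 1 / (4 * M)` has to absorb: the bad-face constants in
  -- degrees `k` and `k + 1`, and the count of heavy weight that multiplies `q`.
  obtain ⟨M, hM⟩ : ∃ M, M = 1 + badConst B F k D + badConst B F (k + 1) D + ((k + 2 : ℕ) : ℝ) * G :=
    ⟨_, rfl⟩
  have hkG : 0 ≤ ((k + 2 : ℕ) : ℝ) * G := by positivity
  have hM1 : 1 ≤ M := by linarith
  obtain ⟨K, hK⟩ : ∃ K, K = 1 / (4 * M) := ⟨_, rfl⟩
  have hK0 : 0 < K := by rw [hK]; positivity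
  have hK1 : K ≤ 1 := by
    rw [hK, div_le_one (by positivity)]
    linarith
  have hKM : ∀ a, a ≤ M → K * a ≤ 1 / 4 := fun a ha => by
    rw [hK, div_mul_eq_mul_div, div_le_iff₀ (by positivity)]
    linarith
  -- The factor `D ^ 2` serves the distance bound for the output; `D * G` serves the smallness
  -- threshold.
  obtain ⟨K', hK'⟩ : ∃ K', K' = K / (D ^ 2 * G) := ⟨_, rfl⟩
  have hK'0 : 0 < K' := by rw [hK']; positivity
  have hK'eq : K' * (D ^ 2 * G) = K := by
    rw [hK', div_mul_cancel₀]
    positivity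
  have hDG : D ≤ D ^ 2 := by nlinarith
  have hK'a : K' * D ^ 2 ≤ K := by
    rw [← hK'eq]
    gcongr
    exact le_mul_of_one_le_right (by positivity) hG1
  have hK'b : K' * (D * G) ≤ 1 := by
    refine le_trans ?_ hK1
    rw [← hK'eq]
    gcongr
  have hK'D : K' * D ≤ K := le_trans (by gcongr) hK'a
  have hK'1 : K' ≤ 1 := by
    refine le_trans ?_ (hK'D.trans hK1)
    exact le_mul_of_one_le_right hK'0.le hD1
  have hK'G : K' * G ≤ 1 := by
    refine le_trans ?_ hK'b
    gcongr
    exact le_mul_of_one_le_left hG0.le hD1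
  refine ⟨K, K', hK0, hK1, hK'0, hK'1, ?_⟩
  intro R _ d _ X _ _ _ hX w hw o hLX hFX P hP P' hP' S ε B' hε0 hε1 hB' h1a h1b h2a h2b
  obtain ⟨c, hc⟩ : ∃ c, c = K * ε := ⟨_, rfl⟩
  rw [← hc] at h2a h2b ⊢
  have hcpos : 0 < c := by rw [hc]; positivity
  have hcle : c ≤ 1 := by rw [hc]; exact mul_le_one₀ hK1 hε0.le hε1
  have hB'0 : 0 < B' := by linarith
  have hB'1 : B'⁻¹ ≤ 1 := inv_le_one_of_one_le₀ hB'
  have hW : WeightBounds X d w ((k : ℤ) + 2) F D := hDdef ▸ weightBounds hX hw hL hLX hFX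
  have hw0 : ∀ x, 0 ≤ w x := fun x => (hw.pos x).le
  have hw1 : ∀ e : X, dim e = -1 → w e = 1 := fun e he => weight_eq_one_of_dim hX hw he
  have hSk := skeletonBound_of_isSkeletonExpander hW hw1 le_rfl (Nat.le_succ k) (by omega) P hB hB'
    hcpos hcle (fun t l r b hq => h2a t l r b (Or.inl hq)) (fun t l r b hq => h2b t l r b (Or.inl hq))
  have hSk' := skeletonBound_of_isSkeletonExpander hW hw1 (Nat.le_succ k) le_rfl (by push_cast; omega)
    P' hB hB' hcpos hcle (fun t l r b hq => h2a t l r b (Or.inr hq))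
    (fun t l r b hq => h2b t l r b (Or.inr hq))
  set q := K * c ^ (2 ^ (k + 1) - 1) with hq
  have hq0 : 0 < q := by positivity
  have hpow : c ^ (2 ^ (k + 2) - 1) ≤ c ^ (2 ^ (k + 1) - 1) :=
    pow_le_pow_of_le_one hcpos.le hcle
      (Nat.sub_le_sub_right (Nat.pow_le_pow_right (by norm_num) (by omega)) 1)
  -- For a stuck cochain, the absence of a correction step is exactly local minimality of its
  -- coboundary with error `q`, so the vanishing statement applies in degree `k + 1`.
  have hstuck : ∀ f : Cochain S k, wnorm w (cobd o f) < B'⁻¹ * c ^ (2 ^ (k + 2) - 1) / G →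
      (∀ f', ¬ CorrectionStep o w S k q f f') → f ∈ cocycles o S k := by
    intro f hsmall hno
    have hzero : cobd o f = 0 := by
      refine eq_zero_of_small (o := o) (m := k + 1) (i := k) rfl (by push_cast; rfl) hP' hW hw1
        (by push_cast; omega) hB hB' hc hcpos hcle hε0 (hKM _ (by linarith)) hSk' ?_ hq0.le ?_
        (f := cobd o f) ?_ ?_ ?_
      · intro u hu hu'
        have h : (k : ℤ) + 1 - dim u - 1 = k - dim u := by ring
        rw [h]
        exact h1b u hu (by push_cast at hu'; exact hu')
      · have h := hKM (((k + 2 : ℕ) : ℝ) * G) (by linarith)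
        calc q * (((k + 1 + 1 : ℕ) : ℝ) * (1 + F : ℝ) ^ (k + 1 + 1))
            = c ^ (2 ^ (k + 1) - 1) * (K * (((k + 2 : ℕ) : ℝ) * G)) := by rw [hq, hG]; ring
          _ ≤ c ^ (2 ^ (k + 1) - 1) * (1 / 4) := by gcongr
          _ = _ := by ring
      · exact LinearMap.mem_ker.2 (coboundary_coboundary o rfl rfl f)
      · rw [lt_div_iff₀ hG0, hG] at hsmall
        rw [mul_comm]
        exact hsmall
      · intro u hu hu' g
        by_contra hlt
        push Not at hlt
        exact hno _ ⟨u, hu, hu', g, hlt, rfl⟩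
    exact LinearMap.mem_ker.2 hzero
  refine ⟨?_, ?_, ?_⟩
  · refine le_cse (by positivity) fun f => ?_
    -- A small coboundary is handled by running the algorithm. A large one needs only that the
    -- distance to the cocycles is at most `‖f‖ ≤ D`.
    rcases lt_or_ge (wnorm w (cobd o f)) (B'⁻¹ * c ^ (2 ^ (k + 2) - 1) / G) with hlt | hge
    · obtain ⟨f', hf'⟩ := exists_correctionOutput (o := o) hw.pos hq0.le f
      obtain ⟨hz, hdist⟩ := hW.correction (by omega) hq0 hstuck hlt hf'
      have h1 := wdistTo_le hw0 f (A := (cocycles o S k : Set (Cochain S k))) hz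
      have h0 := wdistTo_nonneg hw0 f (cocycles o S k : Set (Cochain S k))
      have h2 : D * (B'⁻¹ * K' * c ^ (2 ^ (k + 2) - 1)) ≤ q := by
        calc D * (B'⁻¹ * K' * c ^ (2 ^ (k + 2) - 1))
            ≤ D * (1 * K' * c ^ (2 ^ (k + 1) - 1)) := by gcongr
          _ = (K' * D) * c ^ (2 ^ (k + 1) - 1) := by ring
          _ ≤ q := by rw [hq]; gcongr
      refine le_of_mul_le_mul_left (a := D) ?_ hD0
      calc D * (B'⁻¹ * K' * c ^ (2 ^ (k + 2) - 1) * wdistTo w f (cocycles o S k))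
          = (D * (B'⁻¹ * K' * c ^ (2 ^ (k + 2) - 1))) * wdistTo w f (cocycles o S k) := by ring
        _ ≤ q * wdist w f f' := by gcongr
        _ ≤ _ := hdist
    · have h1 := wdistTo_le hw0 f (A := (cocycles o S k : Set (Cochain S k)))
        (Submodule.zero_mem _)
      rw [wdist, sub_zero] at h1
      have h2 := h1.trans (hW.wnorm_le (by omega) f hw1)
      refine le_trans ?_ hge
      rw [le_div_iff₀ hG0]
      calc B'⁻¹ * K' * c ^ (2 ^ (k + 2) - 1) * wdistTo w f (cocycles o S k) * G
          ≤ B'⁻¹ * K' * c ^ (2 ^ (k + 2) - 1) * D * G := by gcongr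
        _ = B'⁻¹ * c ^ (2 ^ (k + 2) - 1) * (K' * (D * G)) := by ring
        _ ≤ B'⁻¹ * c ^ (2 ^ (k + 2) - 1) * 1 := by gcongr
        _ = _ := mul_one _
  · refine le_ccd fun f hf hlt => ?_
    -- A lightest representative of the class of `f` is locally minimal with no error, hence zero.
    obtain ⟨b, hb, hmin⟩ := exists_min_wnorm (w := w) (fun b : Cochain S k => f + b)
      (s := (coboundaries o S k : Set (Cochain S k))) ⟨0, Submodule.zero_mem _⟩
    have hbz : b ∈ cocycles o S k := by
      obtain ⟨g, rfl⟩ := hb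
      exact LinearMap.mem_ker.2 (coboundary_coboundary o _ rfl g)
    have hle : wnorm w (f + b) ≤ wnorm w f := by
      have := hmin 0 (Submodule.zero_mem _)
      rwa [add_zero] at this
    have hzero : f + b = 0 := by
      refine eq_zero_of_small (o := o) (m := k) (i := (k : ℤ) - 1) (q := 0) (sub_add_cancel _ 1)
        rfl hP hW hw1
        (by omega) hB hB' hc hcpos hcle hε0 (hKM _ (by linarith)) hSk h1a le_rfl ?_
        (Submodule.add_mem _ hf hbz) ?_ ?_
      · rw [zero_mul]
        positivity
      · have h1 : (1 + F : ℝ) ^ (k + 1) ≤ G := by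
          rw [hG]
          exact pow_le_pow_right₀ (by linarith) (by omega)
        calc (1 + F : ℝ) ^ (k + 1) * wnorm w (f + b)
            ≤ G * wnorm w f := by
              have := wnorm_nonneg hw0 (f + b)
              gcongr
          _ < G * (B'⁻¹ * K' * c ^ (2 ^ (k + 1) - 1)) := by gcongr
          _ = (K' * G) * (B'⁻¹ * c ^ (2 ^ (k + 1) - 1)) := by ring
          _ ≤ 1 * (B'⁻¹ * c ^ (2 ^ (k + 1) - 1)) := by gcongr
          _ = _ := one_mul _
      · intro u _ _ g
        rw [zero_mul, sub_zero, add_assoc]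
        exact hmin _ (Submodule.add_mem _ hb ⟨_, rfl⟩)
    rw [eq_neg_of_add_eq_zero_left hzero]
    exact Submodule.neg_mem _ hb
  · intro f hf
    refine ⟨correctionTerminates hw.pos hq0.le f, fun f' hf' => ?_⟩
    have h1 := hW.wnorm_cobd_le_wdistTo (o := o) (by omega) f
    have h0 := wdistTo_nonneg hw0 f (cocycles o S k : Set (Cochain S k))
    -- Closeness to the cocycles makes the coboundary small, which is the condition under which the
    -- algorithm succeeds.
    have h2 : wnorm w (cobd o f) < B'⁻¹ * c ^ (2 ^ (k + 2) - 1) / G := by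
      rw [lt_div_iff₀ hG0]
      calc wnorm w (cobd o f) * G ≤ D * wdistTo w f (cocycles o S k) * G := by gcongr
        _ < D * (B'⁻¹ * K' * c ^ (2 ^ (k + 2) - 1)) * G := by gcongr
        _ = (K' * (D * G)) * (B'⁻¹ * c ^ (2 ^ (k + 2) - 1)) := by ring
        _ ≤ 1 * (B'⁻¹ * c ^ (2 ^ (k + 2) - 1)) := by gcongr
        _ = _ := one_mul _
    obtain ⟨hz, hdist⟩ := hW.correction (by omega) hq0 hstuck h2 hf'
    refine ⟨hz, ?_⟩
    have hc2 : c ^ (2 ^ (k + 1)) ≤ c ^ (2 ^ (k + 1) - 1) :=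
      pow_le_pow_of_le_one hcpos.le hcle (Nat.sub_le _ _)
    have hd0 : 0 ≤ wdist w f f' := wnorm_nonneg hw0 _
    rw [← mul_inv, ← div_eq_inv_mul, le_div_iff₀ (by positivity)]
    -- One factor `D` comes from the distance travelled by the algorithm, the other from bounding
    -- `‖d f‖` by the distance to the cocycles.
    refine le_of_mul_le_mul_left (a := D ^ 2) ?_ (by positivity)
    calc D ^ 2 * (wdist w f f' * (K' * c ^ (2 ^ (k + 1))))
        = (K' * D ^ 2) * c ^ (2 ^ (k + 1)) * wdist w f f' := by ring
      _ ≤ K * c ^ (2 ^ (k + 1) - 1) * wdist w f f' := by gcongr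
      _ ≤ D * wnorm w (cobd o f) := hdist
      _ ≤ D * (D * wdistTo w f (cocycles o S k)) := by gcongr
      _ = _ := by ring
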